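/- For positive integers $m,n$ let $K_{m\times n}$ be the complete multipartite graph with $m$ parts of $n$ vertices each. A $1$-factor of a graph is a spanning subgraph in which every vertex has degree $1$; a $1$-factorization is a set of $1$-factors such that every edge lies in exactly one of them. A group $A$ of permutations of the vertices is an automorphism group of a $1$-factorization if each element of $A$ maps factors to factors; it is sharply transitive if for any vertices $x,y$ there is exactly one $\sigma\in A$ with $\sigma(x)=y$. An abelian $1$-factorization is a $1$-factorization that has an abelian automorphism group acting sharply transitively on the vertices. Write $C_k=\mathbb{Z}_k$ for the cyclic group of order $k$. **Theorem.** 1. If $m=2^v d$ and $n=2d'$ with $d,d'$ odd positive integers and $v\ge 2$, then $K_{m\times n}$ has an abelian $1$-factorization, with a sharply transitive automorphism group isomorphic to $C_d\times C_{2^v d'}\times \mathbb{Z}_2$. 2. If $p$ is a prime with $p\equiv 1 \pmod 4$, then $K_{p\times 2}$ has no abelian $1$-factorization. 3. If $p$ is a prime with $p\equiv 1\pmod 4$ and $v\ge 2$, then $K_{p^v\times 2}$ has an abelian $1$-factorization, with a sharply transitive automorphism group isomorphic to $\mathbb{Z}_{p^{v-1}}\times\mathbb{Z}_p\times\mathbb{Z}_2$.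 4. If $m\equiv 3\pmod 4$ and $d$ is an odd positive integer, then $K_{m\times 2d}$ has no abelian $1$-factorization. -/

import Mathlib

/-- `F` is a 1-factor of `Γ`: a spanning subgraph of `Γ` in which every vertex has exactly one
neighbour. -/
def IsOneFactor {V : Type*} (Γ F : SimpleGraph V) : Prop :=
  F ≤ Γ ∧ ∀ x : V, ∃! y : V, F.Adj x y

/-- `𝓕` is a 1-factorization of `Γ`: a set of 1-factors of `Γ` such that every edge of `Γ` lies in
exactly one of them. -/
def IsOneFactorization {V : Type*} (Γ : SimpleGraph V) (𝓕 : Set (SimpleGraph V)) : Prop :=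
  (∀ F ∈ 𝓕, IsOneFactor Γ F) ∧ ∀ x y : V, Γ.Adj x y → ∃! F : SimpleGraph V, F ∈ 𝓕 ∧ F.Adj x y

/-- `A` is an automorphism group of the 1-factorization `𝓕`: a group of permutations of the
vertices that map factors to factors. -/
def IsFactorizationAutGroup {V : Type*} (𝓕 : Set (SimpleGraph V))
    (A : Subgroup (Equiv.Perm V)) : Prop :=
  ∀ σ ∈ A, ∀ F ∈ 𝓕, F.map σ ∈ 𝓕

/-- The permutation group `A` is sharply transitive (regular) on `V`. -/
def IsSharplyTransitive {V : Type*} (A : Subgroup (Equiv.Perm V)) : Prop :=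
  ∀ x y : V, ∃! σ : Equiv.Perm V, σ ∈ A ∧ σ x = y

/-- `𝓕` is an abelian 1-factorization of `Γ`, with respect to the permutation group `A`: it is a
1-factorization of `Γ`, and `A` is an abelian automorphism group of `𝓕` that is sharply
transitive on the vertices. -/
structure IsAbelianOneFactorization {V : Type*} (Γ : SimpleGraph V) (𝓕 : Set (SimpleGraph V))
    (A : Subgroup (Equiv.Perm V)) : Prop where
  factorization : IsOneFactorization Γ 𝓕
  autGroup : IsFactorizationAutGroup 𝓕 A
  sharplyTransitive : IsSharplyTransitive A
  abelian : ∀ σ ∈ A, ∀ τ ∈ A, σ * τ = τ * σ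

/-! Existence. Let `G` be a finite abelian group with a subgroup `H` of order `n` and index `m`.
Then `K_{m×n}` is the Cayley graph on `G` whose edges are the pairs with difference outside `H`. An
invariant factorization is built by splitting `G \ H` into symmetric sets, each the set of
differences of one perfect matching whose distinct translates are edge-disjoint (a starter). A
difference `g` outside some subgroup of index two needs no design: the edges `{z, z ± g}`, the sign
chosen by the coset of `z`, form a starter. So disjoint starters are needed only to cover the
differences killed by every map to `ZMod 2`; they may use other differences to repair the fixed
points of the reflections from which they are made.

For `2^v d` these are `oddStarter` and the `evenStarter`s, one for each odd part `o`; for `p^v` they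
are `axisStarter` and the `genericStarter`s, one for each `y ≠ 0` up to sign. The axis starter needs
a square root `ω` of `-1`, which exists because `p ≡ 1 (mod 4)`.

Nonexistence. The group contains an involution `j` preserving every part. When the number of
`j`-orbits on vertices is odd, `j` fixes no factor (`IsPartInvolution.map_ne`). For `m ≡ 3 (mod 4)`,
a count of the edges between a transversal `E` of the `j`-orbits and its complement, with the
factors grouped into pairs `{F, jF}`, is contradictory modulo 4. For `K_{p×2}`, the factor through
an edge `{x, g x}` with `g` of order `p` has trivial stabilizer, so its orbit has `2p` elements, but
there are only `2(p-1)` factors. -/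

/-! ### Starters and invariant factorizations of Cayley graphs. -/

/-- Some translation-invariant set of perfect matchings on `G` partitions the pairs `(x, y)` with
`y - x ∈ D`. -/
def HasInvariantFactorization {G : Type*} [AddCommGroup G] (D : Set G) : Prop :=
  ∃ 𝓕 : Set (SimpleGraph G), (∀ F ∈ 𝓕, ∀ x, ∃! y, F.Adj x y) ∧
    (∀ F ∈ 𝓕, ∀ x y, F.Adj x y → y - x ∈ D) ∧
    (∀ F ∈ 𝓕, ∀ g : G, F.map (Equiv.addRight g) ∈ 𝓕) ∧
    ∀ x y, y - x ∈ D → ∃! F, F ∈ 𝓕 ∧ F.Adj x y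

/-- A function `δ` such that the edges `{z, z + δ z}` form a perfect matching whose distinct
translates are edge-disjoint. -/
structure IsStarter {G : Type*} [AddCommGroup G] (δ : G → G) : Prop where
  add_self : ∀ z, δ (z + δ z) = -δ z
  ne_zero : ∀ z, δ z ≠ 0
  periodic : ∀ z z', δ z = δ z' → ∀ w, δ (z + w) = δ (z' + w)

/-- The translate by `g` of the perfect matching given by a starter. -/
def IsStarter.graph {G : Type*} [AddCommGroup G] {δ : G → G} (h : IsStarter δ) (g : G) :
    SimpleGraph G where
  Adj x y := y - x = δ (x - g)
  symm := ⟨fun x y hxy => by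
    have h1 := h.add_self (x - g)
    rw [← hxy, show x - g + (y - x) = y - g by abel] at h1
    rw [h1, neg_sub]⟩
  loopless := ⟨fun x hx => h.ne_zero (x - g) (by rw [← hx, sub_self])⟩

theorem IsStarter.range_neg {G : Type*} [AddCommGroup G] {δ : G → G} (h : IsStarter δ) {x : G}
    (hx : x ∈ Set.range δ) : -x ∈ Set.range δ := by
  obtain ⟨z, rfl⟩ := hx
  exact ⟨_, h.add_self z⟩

theorem map_equiv_adj {V : Type*} (F : SimpleGraph V) (σ : Equiv.Perm V) (x y : V) :
    (F.map σ).Adj x y ↔ F.Adj (σ.symm x) (σ.symm y) := by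
  rw [SimpleGraph.map_adj']
  constructor
  · rintro ⟨-, u, v, huv, rfl, rfl⟩
    simpa using huv
  · intro h
    refine ⟨fun hxy => h.ne (by rw [hxy]), _, _, h, by simp, by simp⟩

/-- A pair with difference `δ z` lies in the translate that moves `z` to its first vertex. If `δ`
takes the same value at `z` and `z'`, then `z - z'` is a period of `δ`, so both give the same
translate: this is the uniqueness. -/
theorem IsStarter.hasInvariantFactorization {G : Type*} [AddCommGroup G] {δ : G → G}
    (h : IsStarter δ) : HasInvariantFactorization (Set.range δ) := by
  refine ⟨Set.range h.graph, ?_, ?_, ?_, ?_⟩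
  · rintro _ ⟨g, rfl⟩ x
    exact ⟨x + δ (x - g), add_sub_cancel_left _ _, fun y hy => by
      rw [← (show y - x = δ (x - g) from hy)]; abel⟩
  · rintro _ ⟨g, rfl⟩ x y hxy
    exact ⟨x - g, (show y - x = δ (x - g) from hxy).symm⟩
  · rintro _ ⟨g, rfl⟩ a
    refine ⟨g + a, ?_⟩
    ext x y
    rw [map_equiv_adj]
    change y - x = δ (x - (g + a)) ↔ (y + -a) - (x + -a) = δ (x + -a - g)
    rw [show y + -a - (x + -a) = y - x by abel, show x - (g + a) = x + -a - g by abel]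
  · rintro x y ⟨z, hz⟩
    refine ⟨h.graph (x - z), ⟨⟨_, rfl⟩, ?_⟩, ?_⟩
    · change y - x = δ (x - (x - z))
      rw [sub_sub_cancel, hz]
    · rintro _ ⟨⟨g, rfl⟩, hg⟩
      have hg' : y - x = δ (x - g) := hg
      ext a b
      change b - a = δ (a - g) ↔ b - a = δ (a - (x - z))
      have := h.periodic z (x - g) (hz.trans hg') (a - x)
      rw [show a - g = x - g + (a - x) by abel, ← this, show a - (x - z) = z + (a - x) by abel]

theorem HasInvariantFactorization.sUnion {G : Type*} [AddCommGroup G] {𝒟 : Set (Set G)}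
    (h : ∀ D ∈ 𝒟, HasInvariantFactorization D)
    (hd : ∀ D ∈ 𝒟, ∀ E ∈ 𝒟, ∀ x, x ∈ D → x ∈ E → D = E) :
    HasInvariantFactorization (⋃₀ 𝒟) := by
  choose! 𝓕 h1 h2 h3 h4 using h
  refine ⟨{F | ∃ D ∈ 𝒟, F ∈ 𝓕 D}, ?_, ?_, ?_, ?_⟩
  · rintro F ⟨D, hD, hF⟩
    exact h1 D hD F hF
  · rintro F ⟨D, hD, hF⟩ x y hxy
    exact ⟨D, hD, h2 D hD F hF x y hxy⟩
  · rintro F ⟨D, hD, hF⟩ g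
    exact ⟨D, hD, h3 D hD F hF g⟩
  · rintro x y ⟨D, hD, hxy⟩
    obtain ⟨F, ⟨hF, hF'⟩, hu⟩ := h4 D hD x y hxy
    refine ⟨F, ⟨⟨D, hD, hF⟩, hF'⟩, ?_⟩
    rintro E ⟨⟨D', hD', hE⟩, hE'⟩
    obtain rfl := hd D' hD' D hD (y - x) (h2 D' hD' E hE x y hE') hxy
    exact hu E ⟨hE, hE'⟩

theorem hasInvariantFactorization_pair {G : Type*} [AddCommGroup G] (φ : G →+ ZMod 2) {g : G}
    (hg : φ g = 1) : HasInvariantFactorization ({g, -g} : Set G) := by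
  classical
  have h2 : ∀ a : ZMod 2, a = 0 ∨ a = 1 := by decide
  have h11 : (1 : ZMod 2) + 1 = 0 := by decide
  let δ : G → G := fun z => if φ z = 0 then g else -g
  have hg0 : g ≠ 0 := by rintro rfl; simp at hg
  have hδ : IsStarter δ := by
    refine ⟨fun z => ?_, fun z => ?_, fun z z' hz w => ?_⟩
    · rcases h2 (φ z) with hz | hz <;> simp [δ, hz, hg, h11]
    · simp only [δ]; split_ifs <;> simpa using hg0
    -- If `g` is an involution the starter is constant and its value says nothing about `φ z`.
    · by_cases hgg : -g = g
      · simp [δ, hgg]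
      · have : φ z = φ z' := by
          rcases h2 (φ z) with h | h <;> rcases h2 (φ z') with h' | h' <;>
            simp [δ, h, h', hgg, Ne.symm hgg] at hz ⊢
        simp only [δ, map_add, this]
  convert hδ.hasInvariantFactorization using 1
  ext x
  constructor
  · rintro (rfl | rfl)
    · exact ⟨0, by simp [δ]⟩
    · exact ⟨g, by simp [δ, hg]⟩
  · rintro ⟨z, rfl⟩
    simp only [δ]; split_ifs <;> simp

/-- Starters whose difference sets are pairwise equal or disjoint, together with the single
differences outside a subgroup of index two, give a factorization. -/
theorem hasInvariantFactorization_of_starters {G ι : Type*} [AddCommGroup G] (δ : ι → G → G)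
    (hδ : ∀ i, IsStarter (δ i)) (D : Set G) (hneg : ∀ x ∈ D, -x ∈ D)
    (hd : ∀ i j z z', δ i z = δ j z' → Set.range (δ i) = Set.range (δ j))
    (hD : ∀ i z, δ i z ∈ D)
    (hcov : ∀ x ∈ D, (∃ i z, δ i z = x) ∨ ∃ φ : G →+ ZMod 2, φ x = 1) :
    HasInvariantFactorization D := by
  have key : HasInvariantFactorization (⋃₀ (Set.range (fun i => Set.range (δ i)) ∪
      {E | ∃ x ∈ D, (¬ ∃ i z, δ i z = x) ∧ E = {x, -x}})) := by
    have hnot : ∀ x, (¬ ∃ i z, δ i z = x) → ¬ ∃ i z, δ i z = -x := by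
      rintro x hx ⟨i, z, hz⟩
      obtain ⟨w, hw⟩ := (hδ i).range_neg ⟨z, hz⟩
      exact hx ⟨i, w, by rw [hw, neg_neg]⟩
    refine HasInvariantFactorization.sUnion ?_ ?_
    · rintro E (⟨i, rfl⟩ | ⟨x, hx, hx', rfl⟩)
      · exact (hδ i).hasInvariantFactorization
      · obtain ⟨φ, hφ⟩ := (hcov x hx).resolve_left hx'
        exact hasInvariantFactorization_pair φ hφ
    · rintro E (⟨i, rfl⟩ | ⟨x, hx, hx', rfl⟩) E' (⟨j, rfl⟩ | ⟨y, hy, hy', rfl⟩) w hw hw'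
      · obtain ⟨z, rfl⟩ := hw
        obtain ⟨z', hz'⟩ := hw'
        exact hd i j z z' hz'.symm
      · obtain ⟨z, rfl⟩ := hw
        rcases hw' with h | h
        · exact absurd ⟨i, z, h⟩ hy'
        · exact absurd ⟨i, z, h⟩ (hnot y hy')
      · obtain ⟨z, rfl⟩ := hw'
        rcases hw with h | h
        · exact absurd ⟨j, z, h⟩ hx'
        · exact absurd ⟨j, z, h⟩ (hnot x hx')
      · rcases hw with rfl | rfl <;> rcases hw' with h | h
        · rw [h]
        · rw [h, neg_neg, Set.pair_comm]
        · rw [← h, neg_neg, Set.pair_comm]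
        · rw [neg_injective h]
  convert key using 1
  ext x
  constructor
  · intro hx
    by_cases h : ∃ i z, δ i z = x
    · obtain ⟨i, z, rfl⟩ := h
      exact ⟨_, Or.inl ⟨i, rfl⟩, z, rfl⟩
    · exact ⟨_, Or.inr ⟨x, hx, h, rfl⟩, Or.inl rfl⟩
  · rintro ⟨E, ⟨i, rfl⟩ | ⟨y, hy, -, rfl⟩, hE⟩
    · obtain ⟨z, rfl⟩ := hE
      exact hD i z
    · rcases hE with rfl | rfl
      · exact hy
      · exact hneg y hy

/-! ### From Cayley graphs to complete equipartite graphs. -/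

theorem exists_equiv_prod_fst_eq_iff {G : Type*} [AddCommGroup G] [Finite G] (H : AddSubgroup G)
    {m n : ℕ} (hm : H.index = m) (hn : Nat.card H = n) :
    ∃ e : G ≃ Fin m × Fin n, ∀ x y, (e x).1 = (e y).1 ↔ y - x ∈ H := by
  subst hm hn
  let e₁ : G ⧸ H ≃ Fin H.index := Finite.equivFin _
  let e₂ : H ≃ Fin (Nat.card H) := Finite.equivFin _
  refine ⟨AddSubgroup.addGroupEquivQuotientProdAddSubgroup.trans (e₁.prodCongr e₂), fun x y => ?_⟩
  have hfst : ∀ z : G, (AddSubgroup.addGroupEquivQuotientProdAddSubgroup (s := H) z).1 =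
      (z : G ⧸ H) := fun z => rfl
  simp only [Equiv.trans_apply, Equiv.prodCongr_apply, Prod.map_fst, hfst,
    EmbeddingLike.apply_eq_iff_eq]
  rw [QuotientAddGroup.eq, neg_add_eq_sub]

/-- The action of an additive group by translations, transported along a bijection. -/
def translationHom {G V : Type*} [AddCommGroup G] (e : G ≃ V) :
    Multiplicative G →* Equiv.Perm V where
  toFun g := e.permCongr (Equiv.addRight g.toAdd)
  map_one' := by ext x; simp
  map_mul' g h := by
    ext x
    simp [add_comm g.toAdd h.toAdd, add_assoc]

theorem translationHom_apply {G V : Type*} [AddCommGroup G] (e : G ≃ V) (g : Multiplicative G)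
    (x : V) : translationHom e g x = e (e.symm x + g.toAdd) := rfl

theorem translationHom_injective {G V : Type*} [AddCommGroup G] (e : G ≃ V) :
    Function.Injective (translationHom e) := by
  intro g h hgh
  have := DFunLike.congr_fun hgh (e 0)
  simpa [translationHom_apply] using this

/-- The cosets of `H` become the parts, and the translations of `G` become the sharply transitive
group. -/
theorem HasInvariantFactorization.exists_isAbelianOneFactorization {G B : Type*} [AddCommGroup G]
    [Finite G] [AddCommGroup B] {H : AddSubgroup G} {m n : ℕ}
    (h : HasInvariantFactorization {x : G | x ∉ H}) (hm : H.index = m) (hn : Nat.card H = n)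
    (b : G ≃+ B) :
    ∃ (𝓕 : Set (SimpleGraph (Fin m × Fin n))) (A : Subgroup (Equiv.Perm (Fin m × Fin n))),
      IsAbelianOneFactorization (SimpleGraph.completeEquipartiteGraph m n) 𝓕 A ∧
      Nonempty (A ≃* Multiplicative B) := by
  obtain ⟨e, he⟩ := exists_equiv_prod_fst_eq_iff H hm hn
  obtain ⟨𝓕, h1, h2, h3, h4⟩ := h
  have hΓ : ∀ x y, (SimpleGraph.completeEquipartiteGraph m n).Adj x y ↔
      e.symm y - e.symm x ∈ {x : G | x ∉ H} := by
    intro x y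
    change _ ↔ ¬ _
    rw [SimpleGraph.completeEquipartiteGraph_adj, ← he]
    simp
  refine ⟨(fun F => F.comap e.symm) '' 𝓕, (translationHom e).range, ⟨⟨?_, ?_⟩, ?_, ?_, ?_⟩,
    ⟨(MonoidHom.ofInjective (translationHom_injective e)).symm.trans b.toMultiplicative⟩⟩
  · rintro _ ⟨F, hF, rfl⟩
    refine ⟨fun x y hxy => (hΓ x y).2 (h2 F hF _ _ hxy), fun x => ?_⟩
    obtain ⟨y, hy, hu⟩ := h1 F hF (e.symm x)
    refine ⟨e y, by simpa using hy, fun z hz => ?_⟩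
    rw [← hu (e.symm z) hz, e.apply_symm_apply]
  · intro x y hxy
    obtain ⟨F, ⟨hF, hF'⟩, hu⟩ := h4 _ _ ((hΓ x y).1 hxy)
    refine ⟨_, ⟨⟨F, hF, rfl⟩, hF'⟩, ?_⟩
    rintro _ ⟨⟨E, hE, rfl⟩, hE'⟩
    rw [hu E ⟨hE, hE'⟩]
  · rintro _ ⟨g, rfl⟩ _ ⟨F, hF, rfl⟩
    refine ⟨_, h3 F hF g.toAdd, ?_⟩
    ext x y
    rw [map_equiv_adj]
    simp only [SimpleGraph.comap_adj]
    rw [map_equiv_adj]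
    have : ∀ z, e.symm ((translationHom e g).symm z) = (Equiv.addRight g.toAdd).symm (e.symm z) := by
      intro z
      rw [Equiv.eq_symm_apply, ← e.apply_eq_iff_eq, e.apply_symm_apply]
      exact (translationHom e g).apply_symm_apply z
    rw [this, this]
  · intro x y
    refine ⟨translationHom e (Multiplicative.ofAdd (e.symm y - e.symm x)), ⟨⟨_, rfl⟩, ?_⟩, ?_⟩
    · rw [translationHom_apply]; simp
    · rintro _ ⟨⟨g, rfl⟩, hg⟩
      congr 1
      rw [translationHom_apply] at hg
      rw [← hg]
      simp
  · rintro _ ⟨g, rfl⟩ _ ⟨g', rfl⟩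
    rw [← map_mul, ← map_mul, mul_comm]

/-! ### Starters when the number of parts is divisible by 4. -/

/-- A starter on `O × R × ZMod 2` whose differences in `2R` have odd part `± o`. -/
def evenStarter {O R : Type*} [AddCommGroup O] [CommRing R] [DecidableEq R] (h : R) (s : R → ℤ)
    (o : O) (z : O × R × ZMod 2) : O × R × ZMod 2 :=
  if z.2.2 = 0 then
    if z.2.1 + z.2.1 = 0 then (o, 1, 1)
    else if z.2.1 + z.2.1 = h + h then (o, h, 1)
    else (s (-(z.2.1 + z.2.1)) • o, -(z.2.1 + z.2.1), 0)
  else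
    if z.2.1 + z.2.1 = 1 + 1 then (-o, -1, 1)
    else if z.2.1 + z.2.1 = 0 then (-o, -h, 1)
    else (s (1 - (z.2.1 + z.2.1)) • o, 1 - (z.2.1 + z.2.1), 0)

section
variable {O R : Type*} [AddCommGroup O] [CommRing R] {π : R →+* ZMod 2} {h : R} {s : R → ℤ}

theorem map_add_self_zmod_two (π : R →+* ZMod 2) (x : R) : π (x + x) = 0 := by
  rw [map_add]; generalize π x = a; revert a; decide

theorem evenStarter_cases [DecidableEq R] (h : R) (s : R → ℤ) (o : O) (z : O × R × ZMod 2) :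
    (z.2.2 = 0 ∧ z.2.1 + z.2.1 = 0 ∧ evenStarter h s o z = (o, 1, 1)) ∨
    (z.2.2 = 0 ∧ z.2.1 + z.2.1 ≠ 0 ∧ z.2.1 + z.2.1 = h + h ∧ evenStarter h s o z = (o, h, 1)) ∨
    (z.2.2 = 0 ∧ z.2.1 + z.2.1 ≠ 0 ∧ z.2.1 + z.2.1 ≠ h + h ∧
      evenStarter h s o z = (s (-(z.2.1 + z.2.1)) • o, -(z.2.1 + z.2.1), 0)) ∨
    (z.2.2 = 1 ∧ z.2.1 + z.2.1 = 1 + 1 ∧ evenStarter h s o z = (-o, -1, 1)) ∨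
    (z.2.2 = 1 ∧ z.2.1 + z.2.1 ≠ 1 + 1 ∧ z.2.1 + z.2.1 = 0 ∧
      evenStarter h s o z = (-o, -h, 1)) ∨
    (z.2.2 = 1 ∧ z.2.1 + z.2.1 ≠ 1 + 1 ∧ z.2.1 + z.2.1 ≠ 0 ∧
      evenStarter h s o z = (s (1 - (z.2.1 + z.2.1)) • o, 1 - (z.2.1 + z.2.1), 0)) := by
  have h2 : z.2.2 = 0 ∨ z.2.2 = 1 := by generalize z.2.2 = a; revert a; decide
  unfold evenStarter
  rcases h2 with h2 | h2 <;> simp only [h2, if_true, one_ne_zero, if_false] <;> split_ifs <;>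
    simp_all

/-- On layer 0 the matching reflects `x ↦ -x`, on layer 1 `x ↦ 1 - x`. The first fixes the roots of
`2x = 0` and would produce the forbidden difference `h + h` where `2x = 2h`; the second has no fixed
point, by parity, but its differences `±1` are left to `oddStarter`. The vertices so removed are
joined across the layers by adding `1` or `h`. The sign `s` makes the odd part change sign together
with the difference. As `h` is even, `1`, `-1`, `h`, `-h` are distinct, so a difference determines
the layer and `2x`, on which alone the starter depends. -/
theorem isStarter_evenStarter [DecidableEq R] (hπ : π h = 0) (h4 : h + h + (h + h) = 0) (h2 : h + h ≠ 0)
    (hs : ∀ w, w ≠ 0 → w ≠ h + h → s (-w) = -s w) (o : O) : IsStarter (evenStarter h s o) := by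
  have e11 : (1 : ZMod 2) + 1 = 0 := by decide
  have h11 : (1 : R) + 1 ≠ 0 := fun h0 => h2 (by rw [← one_mul h, ← add_mul, h0, zero_mul])
  have hp := map_add_self_zmod_two π
  have hh : -(h + h) = h + h := (eq_neg_of_add_eq_zero_left h4).symm
  refine ⟨?_, ?_, ?_⟩
  · rintro ⟨a, x, ε⟩
    rcases evenStarter_cases h s o (a, x, ε) with ⟨rfl, h1, he⟩ | ⟨rfl, h1, h3, he⟩ |
      ⟨rfl, h1, h3, he⟩ | ⟨rfl, h1, he⟩ | ⟨rfl, h1, h3, he⟩ | ⟨rfl, h1, h3, he⟩ <;>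
      rw [he] <;> simp only [Prod.mk_add_mk] at h1 ⊢
    · have : x + 1 + (x + 1) = 1 + 1 := by linear_combination h1
      simp [evenStarter, this]
    · have h5 : x + h + (x + h) = 0 := by linear_combination h3 + h4
      simp [evenStarter, h5, h11.symm]
    · have h5 : x + -(x + x) + (x + -(x + x)) = -(x + x) := by ring
      have h6 : -(x + x) ≠ h + h := fun h' => h3 (by rw [← hh, ← h', neg_neg])
      simp only at h3
      simp only [evenStarter, add_zero, if_true, h5, neg_eq_zero, h1, h6, if_false]
      rw [hs _ (neg_ne_zero.2 h1) h6, neg_smul, Prod.neg_mk, Prod.neg_mk, neg_zero]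
    · have : x + -1 + (x + -1) = 0 := by linear_combination h1
      simp [evenStarter, this, e11]
    · have h5 : x + -h + (x + -h) = h + h := by linear_combination h3 - h4
      simp [evenStarter, h5, h2, e11]
    · have h5 : x + (1 - (x + x)) + (x + (1 - (x + x))) = 1 + 1 - (x + x) := by ring
      have h6 : 1 - (x + x) ≠ 0 := fun h' => by
        have := congrArg π h'; rw [map_sub, hp] at this; simp at this
      have h7 : 1 - (x + x) ≠ h + h := fun h' => by
        have := congrArg π h'; rw [map_sub, hp, hp] at this; simp at this
      simp only at h3
      have h8 : (1 : R) + 1 - (x + x) ≠ 0 := fun h' => h1 (by linear_combination -h')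
      simp only [evenStarter, add_zero, one_ne_zero, if_false, h5, sub_eq_self, h3, h8]
      rw [show 1 - (1 + 1 - (x + x)) = -(1 - (x + x)) by ring, hs _ h6 h7]
      simp
  · intro z hz
    rcases evenStarter_cases h s o z with ⟨h0, h1, he⟩ | ⟨h0, h1, h3, he⟩ |
      ⟨h0, h1, h3, he⟩ | ⟨h0, h1, he⟩ | ⟨h0, h1, h3, he⟩ | ⟨h0, h1, h3, he⟩ <;>
      rw [he] at hz <;> simp at hz
    · exact h1 (by linear_combination -hz.2)
    · have := congrArg π hz.2
      rw [map_sub, hp] at this; simp at this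
  · have h1m : (1 : R) ≠ -1 := fun h' => h11 (by linear_combination h')
    have h1h : (1 : R) ≠ h := fun h' => by have := congrArg π h'; simp [hπ] at this
    have h1h' : (1 : R) ≠ -h := fun h' => by have := congrArg π h'; simp [hπ] at this
    have hmh : h ≠ -h := fun h' => h2 (by linear_combination h')
    have hm1 : h ≠ -1 := fun h' => h1h' (by rw [h', neg_neg])
    have hpar : ∀ x y : R, -(x + x) ≠ 1 - (y + y) := fun x y h' => by
      have := congrArg π h'
      rw [map_sub, map_neg, hp, hp] at this; simp at this
    have key : ∀ z z', evenStarter h s o z = evenStarter h s o z' →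
        z.2.2 = z'.2.2 ∧ z.2.1 + z.2.1 = z'.2.1 + z'.2.1 := by
      intro z z' hz
      rcases evenStarter_cases h s o z with ⟨h0, h1, he⟩ | ⟨h0, h1, h3, he⟩ |
        ⟨h0, h1, h3, he⟩ | ⟨h0, h1, he⟩ | ⟨h0, h1, h3, he⟩ | ⟨h0, h1, h3, he⟩ <;>
      rcases evenStarter_cases h s o z' with ⟨h0', h1', he'⟩ | ⟨h0', h1', h3', he'⟩ |
        ⟨h0', h1', h3', he'⟩ | ⟨h0', h1', he'⟩ | ⟨h0', h1', h3', he'⟩ | ⟨h0', h1', h3', he'⟩ <;>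
      rw [he, he', Prod.mk.injEq, Prod.mk.injEq] at hz <;> obtain ⟨-, hz, hz'⟩ := hz <;>
      first
        | exact absurd hz' (by decide)
        | exact absurd hz ‹_›
        | exact absurd hz.symm ‹_›
        | exact absurd hz (hpar _ _)
        | exact absurd hz.symm (hpar _ _)
        | (refine ⟨h0.trans h0'.symm, ?_⟩; first | rw [h1, h1'] | rw [h3, h3'] | exact neg_injective hz | exact sub_right_injective hz)
        | skip
      all_goals first | exact absurd (neg_injective hz) ‹_› | exact absurd (neg_injective hz).symm ‹_›
    intro z z' hz w
    obtain ⟨h1, h3⟩ := key z z' hz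
    simp only [evenStarter, Prod.snd_add, Prod.fst_add, h1, add_add_add_comm, h3]

theorem evenStarter_eq_imp [DecidableEq R] {o o' : O} (hs : ∀ w, s w = 1 ∨ s w = -1) (hπ : π h = 0)
    (h2 : h + h ≠ 0) {z z' : O × R × ZMod 2}
    (hz : evenStarter h s o z = evenStarter h s o' z') : o = o' := by
  have h11 : (1 : R) + 1 ≠ 0 := fun h0 => h2 (by rw [← one_mul h, ← add_mul, h0, zero_mul])
  have h1m : (1 : R) ≠ -1 := fun h' => h11 (by linear_combination h')
  have h1h : (1 : R) ≠ h := fun h' => by have := congrArg π h'; simp [hπ] at this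
  have h1h' : (1 : R) ≠ -h := fun h' => by have := congrArg π h'; simp [hπ] at this
  have hmh : h ≠ -h := fun h' => h2 (by linear_combination h')
  have hm1 : h ≠ -1 := fun h' => h1h' (by rw [h', neg_neg])
  have hsm : ∀ w (a b : O), s w • a = s w • b → a = b := by
    intro w a b hab
    rcases hs w with h | h <;> simpa [h] using hab
  rcases evenStarter_cases h s o z with ⟨h0, h1, he⟩ | ⟨h0, h1, h3, he⟩ |
        ⟨h0, h1, h3, he⟩ | ⟨h0, h1, he⟩ | ⟨h0, h1, h3, he⟩ | ⟨h0, h1, h3, he⟩ <;>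
      rcases evenStarter_cases h s o' z' with ⟨h0', h1', he'⟩ | ⟨h0', h1', h3', he'⟩ |
        ⟨h0', h1', h3', he'⟩ | ⟨h0', h1', he'⟩ | ⟨h0', h1', h3', he'⟩ | ⟨h0', h1', h3', he'⟩ <;>
      rw [he, he', Prod.mk.injEq, Prod.mk.injEq] at hz <;> obtain ⟨hz'', hz, hz'⟩ := hz <;>
      first
        | exact absurd hz' (by decide)
        | exact hz''
        | exact neg_injective hz''
        | (rw [hz] at hz''; exact hsm _ _ _ hz'')
        | exact absurd hz ‹_›
        | exact absurd hz.symm ‹_›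

/-- A starter on `O × R × ZMod 2` with differences in `(O \ K) × {0, n}` and `K × {1, -1}`. -/
def oddStarter (R : Type*) [CommRing R] (K : AddSubgroup O) [DecidablePred (· ∈ K)]
    (π : R →+* ZMod 2) (n : R) (z : O × R × ZMod 2) : O × R × ZMod 2 :=
  (-(z.1 + z.1), if z.1 ∈ K then (if π z.2.1 = 0 then 1 else -1)
    else (if π z.2.1 = 0 then 0 else n), 0)

/-- The matching reflects `o ↦ -o`. Over `K`, where the reflection has its fixed point `0` and where
differences with second coordinate `0` or `n` would lie in `H`, it also shifts `x` by `±1` according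
to parity. Outside `K` it shifts `x` by `0` or `n`, so that both kinds of difference occur. -/
theorem isStarter_oddStarter (K : AddSubgroup O) [DecidablePred (· ∈ K)] {n : R}
    (hn : n ≠ 0) (hnn : n + n = 0) (hπ : π n = 0) (h11 : (1 : R) + 1 ≠ 0)
    (hO : ∀ x y : O, x + x = y + y → x = y) : IsStarter (oddStarter R K π n) := by
  have e : ∀ a : ZMod 2, a = 0 ∨ a = 1 := by decide
  have e11 : (1 : ZMod 2) + 1 = 0 := by decide
  have hn' : -n = n := (eq_neg_of_add_eq_zero_left hnn).symm
  refine ⟨?_, ?_, ?_⟩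
  · rintro ⟨o, x, ε⟩
    rcases e (π x) with hx | hx <;> by_cases ho : o ∈ K <;>
      simp [oddStarter, hx, ho, hπ, e11, hn']
  · rintro ⟨o, x, ε⟩ hz
    simp only [oddStarter, Prod.mk_eq_zero, neg_eq_zero] at hz
    have ho : o = 0 := hO o 0 (by rw [hz.1, add_zero])
    subst ho
    have h10 : (1 : R) ≠ 0 := fun h' => h11 (by rw [h', add_zero])
    rcases e (π x) with hx | hx <;> simp [hx, h10] at hz
  · rintro ⟨o, x, ε⟩ ⟨o', x', ε'⟩ hz ⟨o'', x'', ε''⟩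
    simp only [oddStarter, Prod.mk.injEq, neg_inj] at hz
    obtain rfl : o = o' := hO _ _ hz.1
    have h1m : (1 : R) ≠ -1 := fun h' => h11 (by linear_combination h')
    have : π x = π x' := by
      rcases e (π x) with hx | hx <;> rcases e (π x') with hx' | hx' <;> by_cases ho : o ∈ K <;>
        simp [hx, hx', ho, h1m, h1m.symm, hn, hn.symm] at hz ⊢
    simp [oddStarter, this]

theorem hasInvariantFactorization_of_even (K : AddSubgroup O) {n h : R} {s : R → ℤ}
    (hn : n ≠ 0) (hnn : n + n = 0) (hπ : π n = 0) (h11 : (1 : R) + 1 ≠ 0)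
    (hh : (∃ w, π w = 0 ∧ w ≠ 0 ∧ w ≠ n) → h + h = n ∧ π h = 0)
    (hR : ∀ w, π w = 0 → ∃ y, y + y = w)
    (hs : ∀ w, s w = 1 ∨ s w = -1) (hs' : ∀ w, w ≠ 0 → w ≠ n → s (-w) = -s w)
    (hO : ∀ x y : O, x + x = y + y → x = y) (hO' : ∀ x : O, ∃ y, y + y = x)
    (hK : ∀ x : O, x + x ∈ K → x ∈ K) :
    HasInvariantFactorization
      {z : O × R × ZMod 2 | ¬ (z.1 ∈ K ∧ (z.2.1 = 0 ∨ z.2.1 = n) ∧ z.2.2 = 0)} := by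
  classical
  have e : ∀ a : ZMod 2, a = 0 ∨ a = 1 := by decide
  have hp := map_add_self_zmod_two π
  have h10 : (1 : R) ≠ 0 := fun h' => h11 (by rw [h', add_zero])
  have h1n : (1 : R) ≠ n := fun h' => by have := congrArg π h'; simp [hπ] at this
  have hm1n : (-1 : R) ≠ n := fun h' => by have := congrArg π h'; simp [hπ] at this
  have hodd : ∀ z : O × R × ZMod 2, (oddStarter R K π n z).2.2 = 0 ∧
      (((oddStarter R K π n z).2.1 = 1 ∨ (oddStarter R K π n z).2.1 = -1) ∨
      ((oddStarter R K π n z).1 ∉ K ∧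
        ((oddStarter R K π n z).2.1 = 0 ∨ (oddStarter R K π n z).2.1 = n))) := by
    rintro ⟨o, x, ε⟩
    refine ⟨rfl, ?_⟩
    by_cases ho : o ∈ K <;> rcases e (π x) with hx | hx <;> simp [oddStarter, ho, hx]
    all_goals right; intro h'; exact ho (hK _ (by simpa using K.neg_mem h'))
  have heven : (h + h = n ∧ π h = 0) → ∀ (o : O) z, (evenStarter h s o z).2.2 = 1 ∨
      ((evenStarter h s o z).2.2 = 0 ∧ (evenStarter h s o z).2.1 ≠ 1 ∧
        (evenStarter h s o z).2.1 ≠ -1 ∧ (evenStarter h s o z).2.1 ≠ 0 ∧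
        (evenStarter h s o z).2.1 ≠ n) := by
    rintro ⟨rfl, hh⟩ o z
    have hh' : -(h + h) = h + h := (eq_neg_of_add_eq_zero_left hnn).symm
    rcases evenStarter_cases h s o z with ⟨h0, h1, he⟩ | ⟨h0, h1, h3, he⟩ |
      ⟨h0, h1, h3, he⟩ | ⟨h0, h1, he⟩ | ⟨h0, h1, h3, he⟩ | ⟨h0, h1, h3, he⟩ <;> rw [he]
    · exact Or.inl rfl
    · exact Or.inl rfl
    · refine Or.inr ⟨rfl, fun h' => ?_, fun h' => ?_, fun h' => h1 (neg_eq_zero.1 h'),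
        fun h' => h3 ?_⟩
      · have := congrArg π h'; simp [-map_add, hp] at this
      · have := congrArg π h'; simp [-map_add, hp] at this
      · rw [← hh', ← h', neg_neg]
    · exact Or.inl rfl
    · exact Or.inl rfl
    · refine Or.inr ⟨rfl, fun h' => h3 (by linear_combination -h'),
        fun h' => h1 (by linear_combination -h'), fun h' => ?_, fun h' => ?_⟩
      · have := congrArg π h'; simp [-map_add, hp] at this
      · have := congrArg π h'; simp [-map_add, hp] at this
  have hdis : (h + h = n ∧ π h = 0) → ∀ (o : O) z z', evenStarter h s o z ≠ oddStarter R K π n z' := by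
    intro hh o z z' hz
    have h1 := heven hh o z
    have h2 := hodd z'
    rw [← hz] at h2
    rcases h1 with h1 | ⟨h1, h3, h4, h5, h6⟩
    · rw [h1] at h2; exact one_ne_zero h2.1
    · tauto
  -- The index `none` stands for the odd starter. If `h` is unsuitable there are no even starters,
  -- and by `hh` none are needed.
  let δ : Option {_o : O // h + h = n ∧ π h = 0} → O × R × ZMod 2 → O × R × ZMod 2 :=
    fun i => i.elim (oddStarter R K π n) (fun o => evenStarter h s o.1)
  refine hasInvariantFactorization_of_starters δ ?_ _ ?_ ?_ ?_ ?_
  · rintro (_ | ⟨o, rfl, hh'⟩)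
    · exact isStarter_oddStarter K hn hnn hπ h11 hO
    · exact isStarter_evenStarter hh' hnn hn hs' o
  · rintro ⟨o, x, ε⟩ hz
    have hn' : -n = n := (eq_neg_of_add_eq_zero_left hnn).symm
    have : -x = n ↔ x = n := by rw [neg_eq_iff_eq_neg, hn']
    simpa [this] using hz
  · rintro (_ | ⟨o, hh⟩) (_ | ⟨o', hh'⟩) z z' hz
    · rfl
    · exact absurd hz.symm (hdis hh' o' z' z)
    · exact absurd hz (hdis hh o z z')
    · rw [evenStarter_eq_imp (o := o) (o' := o') hs hh.2 (by rw [hh.1]; exact hn) hz]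
  · rintro (_ | ⟨o, hh⟩) z ⟨h1, h2, h3⟩
    · have := hodd z
      simp only [δ, Option.elim] at h1 h2 h3
      rcases h2 with h2 | h2 <;> rw [h2] at this <;>
        rcases this with ⟨-, (h4 | h4) | h4⟩
      · exact h10 h4.symm
      · exact h10 (by rw [← neg_neg (1 : R), ← h4, neg_zero])
      · exact h4.1 h1
      · exact h1n h4.symm
      · exact hm1n h4.symm
      · exact h4.1 h1
    · have := heven hh o z
      simp only [δ, Option.elim] at h1 h2 h3
      rw [h3] at this
      rcases this with h4 | h4
      · exact zero_ne_one h4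
      · rcases h2 with h2 | h2
        · exact h4.2.2.2.1 h2
        · exact h4.2.2.2.2 h2
  · rintro ⟨o, x, ε⟩ hz
    rcases e ε with rfl | rfl
    swap
    · exact Or.inr ⟨(AddMonoidHom.snd _ _).comp (AddMonoidHom.snd _ _), rfl⟩
    rcases e (π x) with hx | hx
    swap
    · exact Or.inr ⟨(π : R →+ ZMod 2).comp ((AddMonoidHom.fst _ _).comp (AddMonoidHom.snd _ _)), hx⟩
    left
    by_cases hxn : x = 0 ∨ x = n
    · have ho : o ∉ K := fun ho => hz ⟨ho, hxn, rfl⟩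
      obtain ⟨y, hy⟩ := hO' (-o)
      have hyK : y ∉ K := fun h' => ho (by rw [← neg_neg o, ← hy]; exact K.neg_mem (K.add_mem h' h'))
      rcases hxn with rfl | rfl
      · exact ⟨none, (y, 0, 0), by simp [δ, oddStarter, hyK, hy]⟩
      · exact ⟨none, (y, 1, 0), by simp [δ, oddStarter, hyK, hy]⟩
    · rw [not_or] at hxn
      have hh' := hh ⟨x, hx, hxn.1, hxn.2⟩
      obtain ⟨y, hy⟩ := hR (-x) (by rw [map_neg, hx, neg_zero])
      have hn' : -n = n := (eq_neg_of_add_eq_zero_left hnn).symm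
      have h3 : -x ≠ n := fun h' => hxn.2 (by rw [← hn', ← h', neg_neg])
      -- At `2y = -x` the odd part of the difference is `s x • (s x • o) = o`, since `s x = ±1`.
      refine ⟨some ⟨s x • o, hh'⟩, (0, y, 0), ?_⟩
      simp only [δ, Option.elim, evenStarter, if_true, hy, hh'.1, h3, if_false, neg_eq_zero, hxn.1,
        neg_neg]
      rcases hs x with h' | h' <;> simp [h']
end

theorem ZMod.add_self_injective_of_odd {n : ℕ} (hn : Odd n) (x y : ZMod n) (h : x + x = y + y) :
    x = y := by
  have hu : IsUnit ((2 : ℕ) : ZMod n) :=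
    (ZMod.isUnit_iff_coprime 2 n).2 (Nat.coprime_two_left.2 hn)
  refine hu.mul_left_cancel ?_
  push_cast
  rw [two_mul, two_mul, h]

theorem ZMod.exists_add_self_of_odd {n : ℕ} (hn : Odd n) (x : ZMod n) : ∃ y, y + y = x := by
  have : NeZero n := ⟨by rintro rfl; simp at hn⟩
  exact Finite.surjective_of_injective
    (f := fun x : ZMod n => x + x) (fun x y h => ZMod.add_self_injective_of_odd hn x y h) x

theorem exists_abelianOneFactorization_of_two_pow (v d d' : ℕ) (hv : 2 ≤ v) (hd : Odd d)
    (hd' : Odd d') :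
    ∃ (𝓕 : Set (SimpleGraph (Fin (2 ^ v * d) × Fin (2 * d'))))
      (A : Subgroup (Equiv.Perm (Fin (2 ^ v * d) × Fin (2 * d')))),
      IsAbelianOneFactorization
        (SimpleGraph.completeEquipartiteGraph (2 ^ v * d) (2 * d')) 𝓕 A ∧
      Nonempty (A ≃* Multiplicative (ZMod d × ZMod (2 ^ v * d') × ZMod 2)) := by
  have : NeZero d := ⟨by rintro rfl; simp at hd⟩
  have : NeZero d' := ⟨by rintro rfl; simp at hd'⟩
  obtain ⟨k, rfl⟩ := Nat.exists_eq_add_of_le' hv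
  have hpow : 2 ^ (k + 2) = 2 ^ (k + 1) + 2 ^ (k + 1) := by ring
  have hpos : 0 < 2 ^ (k + 1) := by positivity
  let π : ZMod (2 ^ (k + 2)) →+* ZMod 2 := ZMod.castHom (dvd_pow_self 2 (by omega)) (ZMod 2)
  let n : ZMod (2 ^ (k + 2)) := ((2 ^ (k + 1) : ℕ) : ZMod (2 ^ (k + 2)))
  have hnval : n.val = 2 ^ (k + 1) := by
    rw [ZMod.val_natCast, Nat.mod_eq_of_lt (by omega)]
  have hn0 : n ≠ 0 := by
    rw [← ZMod.val_ne_zero, hnval]; omega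
  have hnn : n + n = 0 := by
    rw [← Nat.cast_add, ← hpow, ZMod.natCast_self]
  have hπval : ∀ w, π w = 0 → ∃ a, w.val = 2 * a := by
    intro w hw
    have : ((w.val : ℕ) : ZMod 2) = 0 := by
      rw [← hw, ← map_natCast π, ZMod.natCast_zmod_val]
    exact (ZMod.natCast_eq_zero_iff _ _).1 this
  -- The odd part of `H` is `K = 0 × ZMod d'`, and its 2-part is generated by the involution `n`.
  -- The element `h` is half of `n`, and `s` separates `w` from `-w` by the half of the residues in
  -- which it lies.
  have hF := hasInvariantFactorization_of_even (O := ZMod d × ZMod d') (π := π)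
    ((⊥ : AddSubgroup (ZMod d)).prod ⊤) (n := n) (h := ((2 ^ k : ℕ) : ZMod (2 ^ (k + 2))))
    (s := fun w => if w.val ≤ 2 ^ (k + 1) then 1 else -1) hn0 hnn
    (by simp only [n, map_natCast, ZMod.natCast_eq_zero_iff]; exact dvd_pow_self 2 (by omega))
    (by
      intro h
      have := congrArg (fun x => ((2 ^ k : ℕ) : ZMod (2 ^ (k + 2))) * x) h
      apply hn0
      simp only [n]
      push_cast at this ⊢
      linear_combination this)
    (by
      rintro ⟨w, hw, hw0, hwn⟩
      refine ⟨by simp only [n]; push_cast; ring, ?_⟩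
      obtain ⟨a, ha⟩ := hπval w hw
      rw [map_natCast, ZMod.natCast_eq_zero_iff]
      apply dvd_pow_self 2
      -- For `k = 0` the element `h = 1` is odd, but the only even residues modulo 4 are `0` and
      -- `n`, so `w` cannot exist.
      rintro rfl
      have h1 := w.val_lt
      rw [← ZMod.val_ne_zero] at hw0
      have h2 : w.val ≠ n.val := fun h => hwn (ZMod.val_injective _ h)
      rw [hnval] at h2
      simp at h1 h2
      omega)
    (by
      intro w hw
      obtain ⟨a, ha⟩ := hπval w hw
      refine ⟨(a : ZMod _), ?_⟩
      rw [← Nat.cast_add, ← two_mul, ← ha, ZMod.natCast_zmod_val])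
    (by intro w; split_ifs <;> simp)
    (by
      intro w hw0 hwn
      have h2 : w.val ≠ n.val := fun h => hwn (ZMod.val_injective _ h)
      rw [hnval] at h2
      have h1 := w.val_lt
      have : NeZero w := ⟨hw0⟩
      rw [ZMod.val_neg_of_ne_zero]
      split_ifs <;> first | rfl | omega)
    (fun x y h => Prod.ext (ZMod.add_self_injective_of_odd hd _ _ (congrArg Prod.fst h))
      (ZMod.add_self_injective_of_odd hd' _ _ (congrArg Prod.snd h)))
    (fun x => by
      obtain ⟨a, ha⟩ := ZMod.exists_add_self_of_odd hd x.1
      obtain ⟨b, hb⟩ := ZMod.exists_add_self_of_odd hd' x.2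
      exact ⟨(a, b), Prod.ext ha hb⟩)
    (by
      rintro ⟨a, b⟩ h
      rw [AddSubgroup.mem_prod] at h ⊢
      exact ⟨ZMod.add_self_injective_of_odd hd _ _ (by simpa using h.1), trivial⟩)
  let H : AddSubgroup ((ZMod d × ZMod d') × ZMod (2 ^ (k + 2)) × ZMod 2) :=
    ((⊥ : AddSubgroup (ZMod d)).prod ⊤).prod ((AddSubgroup.zmultiples n).prod ⊥)
  have hord : addOrderOf n = 2 := addOrderOf_eq_prime (by rw [two_nsmul, hnn]) hn0
  have hmem : ∀ x, x ∈ AddSubgroup.zmultiples n ↔ x = 0 ∨ x = n := by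
    intro x
    constructor
    · intro hx
      obtain ⟨i, hi, rfl⟩ := (mem_zmultiples_iff_mem_range_addOrderOf (x := n)).1 hx |>
        Finset.mem_image.1
      rw [hord, Finset.mem_range] at hi
      interval_cases i <;> simp
    · rintro (rfl | rfl)
      · exact zero_mem _
      · exact AddSubgroup.mem_zmultiples _
  have hcard : Nat.card H = 2 * d' := by
    rw [Nat.card_congr (AddSubgroup.prodEquiv _ _).toEquiv, Nat.card_prod,
      Nat.card_congr (AddSubgroup.prodEquiv _ _).toEquiv, Nat.card_prod,
      Nat.card_congr (AddSubgroup.prodEquiv _ _).toEquiv, Nat.card_prod,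
      Nat.card_zmultiples, hord]
    simp [mul_comm]
  have hindex : H.index = 2 ^ (k + 2) * d := by
    have h := H.card_mul_index
    simp only [hcard, Nat.card_prod, Nat.card_zmod] at h
    have hd'0 : 0 < 2 * d' := by have := NeZero.pos d'; omega
    apply Nat.eq_of_mul_eq_mul_left hd'0
    rw [h]; ring
  have hHF : HasInvariantFactorization {x | x ∉ H} := by
    convert hF using 1
    ext z
    simp only [Set.mem_ofPred_eq, H, AddSubgroup.mem_prod, hmem, AddSubgroup.mem_bot]
  have hcop : (2 ^ (k + 2)).Coprime d' := (Nat.coprime_two_left.2 hd').pow_left _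
  refine hHF.exists_isAbelianOneFactorization hindex hcard
    (AddEquiv.prodAssoc.trans ((AddEquiv.refl _).prodCongr (AddEquiv.prodAssoc.symm.trans
      (AddEquiv.prodCongr (AddEquiv.prodComm.trans
        (ZMod.chineseRemainder hcop).symm.toAddEquiv) (AddEquiv.refl _)))))

/-! ### Starters when the number of parts is a prime power. -/

section
variable {Q P : Type*} [CommRing Q] [AddCommGroup P]

/-- A starter on `Q × P × ZMod 2` with differences `(x, ± y, 0)`, `x ≠ 0`, and `(0, ± y, 1)`. -/
def genericStarter [DecidableEq Q] (σ : Q → ℤ) (y : P) (z : Q × P × ZMod 2) : Q × P × ZMod 2 :=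
  if z.1 = 0 then (0, if z.2.2 = 0 then y else -y, 1)
  else (-(z.1 + z.1), (if z.2.2 = 0 then σ z.1 else -σ z.1) • y, 0)

variable {σ : Q → ℤ}

/-- The matching reflects `x ↦ -x` within each layer, and joins the two layers over the only fixed
point `x = 0`. The opposite signs on the two layers produce both `y` and `-y` over every `x ≠ 0`. -/
theorem isStarter_genericStarter [DecidableEq Q] (hσ : ∀ x, x ≠ 0 → σ (-x) = -σ x)
    (hσ' : ∀ x, σ x = 1 ∨ σ x = -1) (hQ : ∀ x y : Q, x + x = y + y → x = y) {y : P}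
    (hy : y ≠ -y) : IsStarter (genericStarter σ y) := by
  have e : ∀ a : ZMod 2, a = 0 ∨ a = 1 := by decide
  have e11 : (1 : ZMod 2) + 1 = 0 := by decide
  have hQ0 : ∀ x : Q, x + x = 0 → x = 0 := fun x hx => hQ x 0 (by rw [hx, add_zero])
  refine ⟨?_, ?_, ?_⟩
  · rintro ⟨x, w, ε⟩
    by_cases hx : x = 0
    · rcases e ε with rfl | rfl <;> simp [genericStarter, hx, e11]
    · rcases e ε with rfl | rfl <;> simp [genericStarter, hx, hσ x hx]
  · rintro ⟨x, w, ε⟩ hz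
    by_cases hx : x = 0
    · simp [genericStarter, hx] at hz
    · simp only [genericStarter, hx, if_false, Prod.mk_eq_zero, neg_eq_zero] at hz
      exact hx (hQ0 x hz.1)
  · rintro ⟨x, w, ε⟩ ⟨x', w', ε'⟩ hz ⟨x'', w'', ε''⟩
    obtain ⟨rfl, rfl⟩ : x = x' ∧ ε = ε' := by
      by_cases hx : x = 0 <;> by_cases hx' : x' = 0 <;>
        simp only [genericStarter, hx, hx', if_true, if_false, Prod.mk.injEq, zero_ne_one,
          one_ne_zero, and_false, and_true, true_and, neg_inj] at hz
      · refine ⟨hx.trans hx'.symm, ?_⟩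
        rcases e ε with rfl | rfl <;> rcases e ε' with rfl | rfl <;>
          simp [hy, hy.symm] at hz ⊢
      · obtain rfl := hQ _ _ hz.1
        refine ⟨rfl, ?_⟩
        rcases e ε with rfl | rfl <;> rcases e ε' with rfl | rfl <;> rcases hσ' x with h | h <;>
          simp [hy, hy.symm, h] at hz ⊢
    simp [genericStarter]

/-- Changing the sign of `y` amounts to exchanging the two layers. -/
theorem range_genericStarter_neg [DecidableEq Q] (y : P) :
    Set.range (genericStarter σ (-y)) = Set.range (genericStarter σ y) := by
  have e : ∀ a : ZMod 2, a = 0 ∨ a = 1 := by decide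
  have e11 : (1 : ZMod 2) + 1 = 0 := by decide
  have key : ∀ y : P, ∀ x w ε, genericStarter σ (-y) (x, w, ε) =
      genericStarter σ y (x, w, ε + 1) := by
    intro y x w ε
    by_cases hx : x = 0 <;> rcases e ε with rfl | rfl <;> simp [genericStarter, hx, e11]
  ext t
  constructor
  · rintro ⟨⟨x, w, ε⟩, rfl⟩
    exact ⟨_, (key y x w ε).symm⟩
  · rintro ⟨⟨x, w, ε⟩, rfl⟩
    exact ⟨_, ((congrArg (genericStarter σ · _) (neg_neg y).symm).trans (key (-y) x w ε)).symm⟩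

theorem eq_or_eq_neg_of_genericStarter_eq [DecidableEq Q] (hσ' : ∀ x, σ x = 1 ∨ σ x = -1) {y y' : P}
    {z z' : Q × P × ZMod 2} (h : genericStarter σ y z = genericStarter σ y' z') :
    y = y' ∨ y = -y' := by
  have h2 := congrArg (fun t => t.2.1) h
  have key : ∀ (y : P) (z : Q × P × ZMod 2), (genericStarter σ y z).2.1 = y ∨
      (genericStarter σ y z).2.1 = -y := by
    intro y z
    unfold genericStarter
    rcases hσ' z.1 with h | h <;> split_ifs <;> simp [h]
  rcases key y z with h | h <;> rcases key y' z' with h' | h' <;> simp only [h, h'] at h2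
  · exact Or.inl h2
  · exact Or.inr h2
  · exact Or.inr (by rw [← h2, neg_neg])
  · exact Or.inl (neg_injective h2)

theorem genericStarter_cases [DecidableEq Q] (hσ' : ∀ x, σ x = 1 ∨ σ x = -1)
    (hQ : ∀ x y : Q, x + x = y + y → x = y) {y : P} (hy : y ≠ 0) (z : Q × P × ZMod 2) :
    (genericStarter σ y z).2.1 ≠ 0 ∧
      ((genericStarter σ y z).1 = 0 ↔ (genericStarter σ y z).2.2 = 1) := by
  have hQ0 : ∀ x : Q, x + x = 0 → x = 0 := fun x hx => hQ x 0 (by rw [hx, add_zero])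
  unfold genericStarter
  by_cases hx : z.1 = 0
  · simp only [hx, if_true]
    split_ifs <;> simp [hy]
  · have : z.1 + z.1 ≠ 0 := fun h => hx (hQ0 _ h)
    rcases hσ' z.1 with h | h <;> simp only [hx, if_false, h] <;> split_ifs <;>
      simp [hy] <;> simpa [neg_add_eq_zero, eq_neg_iff_add_eq_zero] using this

open Classical in
/-- A starter on `Q × P × ZMod 2` with differences `(x, 0, 0)`, `(0, y, 0)` and some
`(t, ± e, 1)`, `t ≠ 0`; it depends only on `u = x - c y` and on the last coordinate. -/
noncomputable def axisStarter (c : P →+ Q) (l : Q → P) (ω : Q) (A : Q → Prop) (e : P)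
    (z : Q × P × ZMod 2) : Q × P × ZMod 2 :=
  if z.2.2 = 0 then
    if z.1 - c z.2.1 = 0 ∨ (z.1 - c z.2.1 ∉ Set.range c ∧ A (z.1 - c z.2.1)) then
      ((ω - 1) * (z.1 - c z.2.1) + c e, e, 1)
    else if z.1 - c z.2.1 ∈ Set.range c then (0, l (z.1 - c z.2.1) + l (z.1 - c z.2.1), 0)
    else (-((z.1 - c z.2.1) + (z.1 - c z.2.1)), 0, 0)
  else
    if z.1 - c z.2.1 = 0 ∨ (z.1 - c z.2.1 ∉ Set.range c ∧ ¬ A (z.1 - c z.2.1)) then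
      (-(1 + ω) * (z.1 - c z.2.1) - c e, -e, 1)
    else (-((z.1 - c z.2.1) + (z.1 - c z.2.1)), 0, 0)

variable {c : P →+ Q} {l : Q → P} {ω : Q} {A : Q → Prop} {e : P}

theorem axisStarter_cases (c : P →+ Q) (l : Q → P) (ω : Q) (A : Q → Prop) (e : P)
    (z : Q × P × ZMod 2) {u : Q} (hu : z.1 - c z.2.1 = u) :
    (z.2.2 = 0 ∧ (u = 0 ∨ (u ∉ Set.range c ∧ A u)) ∧
      axisStarter c l ω A e z = ((ω - 1) * u + c e, e, 1)) ∨
    (z.2.2 = 0 ∧ u ≠ 0 ∧ u ∈ Set.range c ∧ axisStarter c l ω A e z = (0, l u + l u, 0)) ∨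
    (z.2.2 = 0 ∧ u ≠ 0 ∧ u ∉ Set.range c ∧ ¬ A u ∧
      axisStarter c l ω A e z = (-(u + u), 0, 0)) ∨
    (z.2.2 = 1 ∧ (u = 0 ∨ (u ∉ Set.range c ∧ ¬ A u)) ∧
      axisStarter c l ω A e z = (-(1 + ω) * u - c e, -e, 1)) ∨
    (z.2.2 = 1 ∧ u ≠ 0 ∧ (u ∈ Set.range c ∨ A u) ∧
      axisStarter c l ω A e z = (-(u + u), 0, 0)) := by
  have h2 : z.2.2 = 0 ∨ z.2.2 = 1 := by generalize z.2.2 = a; revert a; decide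
  subst hu
  rcases h2 with h2 | h2
  · by_cases h : z.1 - c z.2.1 = 0 ∨ (z.1 - c z.2.1 ∉ Set.range c ∧ A (z.1 - c z.2.1))
    · exact Or.inl ⟨h2, h, by rw [axisStarter, if_pos h2, if_pos h]⟩
    · by_cases h' : z.1 - c z.2.1 ∈ Set.range c
      · exact Or.inr (Or.inl ⟨h2, fun h0 => h (Or.inl h0), h', by
          rw [axisStarter, if_pos h2, if_neg h, if_pos h']⟩)
      · exact Or.inr (Or.inr (Or.inl ⟨h2, fun h0 => h (Or.inl h0), h',
          fun h0 => h (Or.inr ⟨h', h0⟩), by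
            rw [axisStarter, if_pos h2, if_neg h, if_neg h']⟩))
  · have h2' : z.2.2 ≠ 0 := by rw [h2]; exact one_ne_zero
    by_cases h : z.1 - c z.2.1 = 0 ∨ (z.1 - c z.2.1 ∉ Set.range c ∧ ¬ A (z.1 - c z.2.1))
    · exact Or.inr (Or.inr (Or.inr (Or.inl ⟨h2, h, by rw [axisStarter, if_neg h2', if_pos h]⟩)))
    · exact Or.inr (Or.inr (Or.inr (Or.inr ⟨h2, fun h0 => h (Or.inl h0), by tauto, by
        rw [axisStarter, if_neg h2', if_neg h]⟩)))

/-- In the coordinate `u = x - c y` the differences `(-2u, 0, 0)` and `(0, 2 l u, 0)` both act as `u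
↦ -u`. The first is used once for each `u ≠ 0`, on one layer or the other; the second on layer 0 for
`u ≠ 0` in the range of `c`. What remains is `0` on both layers and, off the range, the `u` with `A
u` on layer 0 and those without on layer 1. Multiplication by `ω` exchanges these two sets and gives
the edges between layers. The shift by `e ≠ 0` keeps the edge at `u = 0` out of `H`. -/
theorem isStarter_axisStarter (hQ : ∀ x y : Q, x + x = y + y → x = y)
    (hl : ∀ y, c (l (c y)) = c y) (hc : Function.Injective c)
    (hω : ω * ω = -1) (hcω : ∀ u, ω * u ∈ Set.range c ↔ u ∈ Set.range c)
    (hA : ∀ u, A (-u) ↔ A u) (hAω : ∀ u, u ≠ 0 → (A (ω * u) ↔ ¬ A u))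
    (he : e ≠ -e) : IsStarter (axisStarter c l ω A e) := by
  have e11 : (1 : ZMod 2) + 1 = 0 := by decide
  have hQ0 : ∀ x : Q, x + x = 0 → x = 0 := fun x hx => hQ x 0 (by rw [hx, add_zero])
  have hneg : ∀ u, -u ∈ Set.range c ↔ u ∈ Set.range c := by
    intro u
    constructor
    · rintro ⟨y, hy⟩; exact ⟨-y, by rw [map_neg, hy, neg_neg]⟩
    · rintro ⟨y, rfl⟩; exact ⟨-y, by rw [map_neg]⟩
  have hl' : ∀ u ∈ Set.range c, c (l u) = u := by rintro _ ⟨y, rfl⟩; exact hl y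
  have hA0 : ∀ u : Q, u ∉ Set.range c → u ≠ 0 := by
    rintro u hu rfl; exact hu ⟨0, map_zero c⟩
  refine ⟨?_, ?_, ?_⟩
  · intro z
    obtain ⟨u, hu⟩ : ∃ u, z.1 - c z.2.1 = u := ⟨_, rfl⟩
    have hst : ∀ (t : Q × P × ZMod 2), (z + t).1 - c (z + t).2.1 = u + t.1 - c t.2.1 := by
      intro t; rw [← hu]; simp only [Prod.fst_add, Prod.snd_add, map_add]; ring
    rcases axisStarter_cases c l ω A e z hu with ⟨h0, h1, hz⟩ | ⟨h0, h1, h2, hz⟩ |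
      ⟨h0, h1, h2, h3, hz⟩ | ⟨h0, h1, hz⟩ | ⟨h0, h1, h2, hz⟩ <;> rw [hz]
    · have hs := hst ((ω - 1) * u + c e, e, 1)
      rw [show u + ((ω - 1) * u + c e) - c e = ω * u by ring] at hs
      have h4 : ω * u = 0 ∨ (ω * u ∉ Set.range c ∧ ¬ A (ω * u)) := by
        rcases h1 with rfl | ⟨h1, h1'⟩
        · exact Or.inl (mul_zero _)
        · exact Or.inr ⟨by rwa [hcω], by rwa [hAω u (hA0 u h1), not_not]⟩
      rcases axisStarter_cases c l ω A e _ hs with ⟨h5, -⟩ | ⟨h5, -⟩ | ⟨h5, -⟩ | ⟨h5, h6, hz'⟩ |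
        ⟨h5, h6, h7, hz'⟩
      iterate 3 simp [h0] at h5
      · rw [hz']
        refine Prod.ext ?_ (Prod.ext rfl (show (1 : ZMod 2) = -1 by decide))
        change -(1 + ω) * (ω * u) - c e = -((ω - 1) * u + c e)
        linear_combination -u * hω
      · tauto
    · have hs := hst (0, l u + l u, 0)
      rw [map_add, hl' u h2, show u + 0 - (u + u) = -u by ring] at hs
      rcases axisStarter_cases c l ω A e _ hs with ⟨h5, h6, hz'⟩ | ⟨h5, h6, h7, hz'⟩ |
        ⟨h5, h6, h7, h8, hz'⟩ | ⟨h5, -⟩ | ⟨h5, -⟩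
      · rw [hneg, neg_eq_zero] at h6; tauto
      · rw [hz']
        have : l (-u) = -l u := hc (by rw [map_neg, hl' _ ((hneg u).2 h2), hl' u h2])
        rw [this]
        refine Prod.ext (by simp) (Prod.ext (by simp) (by simp))
      · rw [hneg] at h7; tauto
      iterate 2 simp [h0] at h5
    · have hs := hst (-(u + u), 0, 0)
      rw [map_zero, show u + -(u + u) - 0 = -u by ring] at hs
      rcases axisStarter_cases c l ω A e _ hs with ⟨h5, h6, hz'⟩ | ⟨h5, h6, h7, hz'⟩ |
        ⟨h5, h6, h7, h8, hz'⟩ | ⟨h5, -⟩ | ⟨h5, -⟩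
      · rw [hneg, neg_eq_zero, hA] at h6; tauto
      · rw [hneg] at h7; tauto
      · rw [hz']; simp
      iterate 2 simp [h0] at h5
    · have hs := hst (-(1 + ω) * u - c e, -e, 1)
      rw [map_neg, show u + (-(1 + ω) * u - c e) - -c e = -(ω * u) by ring] at hs
      have h4 : -(ω * u) = 0 ∨ (-(ω * u) ∉ Set.range c ∧ A (-(ω * u))) := by
        rcases h1 with rfl | ⟨h1, h1'⟩
        · exact Or.inl (by simp)
        · exact Or.inr ⟨by rwa [hneg, hcω], by rwa [hA, hAω u (hA0 u h1)]⟩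
      rcases axisStarter_cases c l ω A e _ hs with ⟨h5, h6, hz'⟩ | ⟨h5, h6, h7, hz'⟩ |
        ⟨h5, h6, h7, h8, hz'⟩ | ⟨h5, -⟩ | ⟨h5, -⟩
      · rw [hz']
        refine Prod.ext ?_ (Prod.ext (by simp) (show (1 : ZMod 2) = -1 by decide))
        change (ω - 1) * -(ω * u) + c e = -(-(1 + ω) * u - c e)
        linear_combination -u * hω
      · tauto
      · tauto
      iterate 2 simp [h0, e11] at h5
    · have hs := hst (-(u + u), 0, 0)
      rw [map_zero, show u + -(u + u) - 0 = -u by ring] at hs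
      rcases axisStarter_cases c l ω A e _ hs with ⟨h5, h6, hz'⟩ | ⟨h5, h6, h7, hz'⟩ |
        ⟨h5, h6, h7, h8, hz'⟩ | ⟨h5, h6, hz'⟩ | ⟨h5, h6, h7, hz'⟩
      iterate 3 simp [h0] at h5
      · rw [hneg, neg_eq_zero, hA] at h6; tauto
      · rw [hz']; simp
  · intro z hz
    rcases axisStarter_cases c l ω A e z rfl with ⟨h0, h1, he⟩ | ⟨h0, h1, h2, he⟩ |
      ⟨h0, h1, h2, h3, he⟩ | ⟨h0, h1, he⟩ | ⟨h0, h1, h2, he⟩ <;>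
      rw [he, Prod.mk_eq_zero, Prod.mk_eq_zero] at hz
    · exact one_ne_zero hz.2.2
    · exact h1 (hQ0 _ (by rw [← hl' _ h2, ← map_add, hz.2.1, map_zero]))
    · exact h1 (hQ0 _ (neg_eq_zero.1 hz.1))
    · exact one_ne_zero hz.2.2
    · exact h1 (hQ0 _ (neg_eq_zero.1 hz.1))
  · have key : ∀ z z', axisStarter c l ω A e z = axisStarter c l ω A e z' →
        z.2.2 = z'.2.2 ∧ z.1 - c z.2.1 = z'.1 - c z'.2.1 := by
      intro z z' hz
      obtain ⟨u, hu⟩ : ∃ u, z.1 - c z.2.1 = u := ⟨_, rfl⟩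
      obtain ⟨u', hu'⟩ : ∃ u, z'.1 - c z'.2.1 = u := ⟨_, rfl⟩
      rw [hu, hu']
      have hll : ∀ u ∈ Set.range c, u ≠ 0 → l u + l u ≠ 0 := fun u h2 h1 h3 =>
        h1 (hQ0 _ (by rw [← hl' _ h2, ← map_add, h3, map_zero]))
      have hnn : -(u + u) = -(u' + u') → u = u' := fun h => hQ _ _ (neg_injective h)
      rcases axisStarter_cases c l ω A e z hu with ⟨h0, h1, h⟩ | ⟨h0, h1, h2, h⟩ |
        ⟨h0, h1, h2, h3, h⟩ | ⟨h0, h1, h⟩ | ⟨h0, h1, h2, h⟩ <;>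
      rcases axisStarter_cases c l ω A e z' hu' with ⟨h0', h1', h'⟩ | ⟨h0', h1', h2', h'⟩ |
        ⟨h0', h1', h2', h3', h'⟩ | ⟨h0', h1', h'⟩ | ⟨h0', h1', h2', h'⟩ <;>
      rw [h, h', Prod.mk.injEq, Prod.mk.injEq] at hz <;> obtain ⟨ha, hb, hd⟩ := hz <;>
      first
        | exact absurd hd (by decide)
        | exact absurd hb he
        | exact absurd hb.symm he
        | exact absurd hb (hll _ ‹_› ‹_›)
        | exact absurd hb.symm (hll _ ‹_› ‹_›)
        | (refine ⟨h0.trans h0'.symm, ?_⟩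
           first
             | exact hnn ha
             -- Since `ω² = -1`, `(ω - 1)(-ω - 1) = 2`, so the factors `ω ± 1` cancel.
             | exact hQ _ _ (by linear_combination (-ω - 1) * ha + (u - u') * hω)
             | exact hQ _ _ (by linear_combination (ω - 1) * ha + (u - u') * hω)
             | exact hQ _ _ (by rw [← hl' u ‹_›, ← hl' u' ‹_›, ← map_add, ← map_add, hb]))
        | (obtain rfl := hnn ha; tauto)
    intro z z' hz w
    obtain ⟨h1, h2⟩ := key z z' hz
    have h3 : (z + w).1 - c (z + w).2.1 = (z' + w).1 - c (z' + w).2.1 := by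
      simp only [Prod.fst_add, Prod.snd_add, map_add]; linear_combination h2
    have h4 : (z + w).2.2 = (z' + w).2.2 := by simp only [Prod.snd_add, h1]
    rw [axisStarter, axisStarter, h3, h4]

/-- This separates the axis starter from the generic ones. A difference `(0, ±e, 1)` would express
`2u` through `c e` and `ω * c e`, hence put `u` in the range of `c`, where only `u = 0` is joined
across layers; there the first coordinate is `± c e ≠ 0`. -/
theorem axisStarter_values (hQ : ∀ x y : Q, x + x = y + y → x = y) (hP : ∀ x : P, ∃ y, y + y = x)
    (hc : Function.Injective c)
    (hω : ω * ω = -1) (hcω : ∀ u, ω * u ∈ Set.range c ↔ u ∈ Set.range c)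
    (hl : ∀ y, c (l (c y)) = c y) (he : e ≠ 0) (z : Q × P × ZMod 2) :
    ((axisStarter c l ω A e z).2.2 = 1 ∧ (axisStarter c l ω A e z).1 ≠ 0) ∨
    ((axisStarter c l ω A e z).2.2 = 0 ∧ ((axisStarter c l ω A e z).1 = 0 ↔
      (axisStarter c l ω A e z).2.1 ≠ 0)) := by
  have hQ0 : ∀ x : Q, x + x = 0 → x = 0 := fun x hx => hQ x 0 (by rw [hx, add_zero])
  have hl' : ∀ u ∈ Set.range c, c (l u) = u := by rintro _ ⟨y, rfl⟩; exact hl y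
  have hce : c e ≠ 0 := fun h => he (hc (h.trans (map_zero c).symm))
  have hcω' : ∀ u y, u + u = ω * c y - c y → u ∈ Set.range c := by
    intro u y hu
    obtain ⟨w, hw⟩ := (hcω (c y)).2 ⟨y, rfl⟩
    obtain ⟨t, ht⟩ := hP (w - y)
    exact ⟨t, hQ _ _ (by rw [hu, ← map_add, ht, map_sub, hw])⟩
  have hcω'' : ∀ u y, u + u = ω * c y + c y → u ∈ Set.range c := by
    intro u y hu
    obtain ⟨w, hw⟩ := (hcω (c y)).2 ⟨y, rfl⟩
    obtain ⟨t, ht⟩ := hP (w + y)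
    exact ⟨t, hQ _ _ (by rw [hu, ← map_add, ht, map_add, hw])⟩
  obtain ⟨u, hu⟩ : ∃ u, z.1 - c z.2.1 = u := ⟨_, rfl⟩
  rcases axisStarter_cases c l ω A e z hu with ⟨h0, h1, h⟩ | ⟨h0, h1, h2, h⟩ |
        ⟨h0, h1, h2, h3, h⟩ | ⟨h0, h1, h⟩ | ⟨h0, h1, h2, h⟩ <;> rw [h]
  · refine Or.inl ⟨rfl, fun h' => ?_⟩
    simp only at h'
    rcases h1 with rfl | ⟨h1, -⟩
    · exact hce (by simpa using h')
    · exact h1 (hcω'' u e (by linear_combination (-1 - ω) * h' + u * hω))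
  · refine Or.inr ⟨rfl, iff_of_true rfl fun h' => h1 (hQ0 _ ?_)⟩
    rw [← hl' _ h2, ← map_add, show l u + l u = 0 from h', map_zero]
  · exact Or.inr ⟨rfl, iff_of_false (fun h' => h1 (hQ0 _ (neg_eq_zero.1 h'))) fun h' => h' rfl⟩
  · refine Or.inl ⟨rfl, fun h' => ?_⟩
    simp only at h'
    rcases h1 with rfl | ⟨h1, -⟩
    · exact hce (by simpa using h')
    · exact h1 (hcω' u e (by linear_combination (ω - 1) * h' + u * hω))
  · exact Or.inr ⟨rfl, iff_of_false (fun h' => h1 (hQ0 _ (neg_eq_zero.1 h'))) fun h' => h' rfl⟩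

theorem hasInvariantFactorization_of_sq_eq_neg_one (hQ : ∀ x y : Q, x + x = y + y → x = y)
    (hQ' : ∀ x : Q, ∃ y, y + y = x) (hP : ∀ x y : P, x + x = y + y → x = y)
    (hP' : ∀ x : P, ∃ y, y + y = x) (hc : Function.Injective c)
    (hω : ω * ω = -1) (hcω : ∀ u, ω * u ∈ Set.range c ↔ u ∈ Set.range c)
    (hσ : ∀ x, x ≠ 0 → σ (-x) = -σ x) (hσ' : ∀ x, σ x = 1 ∨ σ x = -1)
    (hA : ∀ u, A (-u) ↔ A u) (hAω : ∀ u, u ≠ 0 → (A (ω * u) ↔ ¬ A u)) (he : e ≠ 0) :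
    HasInvariantFactorization {z : Q × P × ZMod 2 | ¬ (z.1 = 0 ∧ z.2.1 = 0)} := by
  classical
  have h2 : ∀ a : ZMod 2, a = 0 ∨ a = 1 := by decide
  have hne : ∀ y : P, y ≠ 0 → y ≠ -y := fun y hy h => hy (hP y 0 (by
    rw [add_zero]; exact eq_neg_iff_add_eq_zero.1 h))
  -- `axisStarter` evaluates `l` only on the range of `c`, so the arbitrary values of `invFun`
  -- elsewhere play no role.
  have hl : ∀ y, c (Function.invFun c (c y)) = c y := fun y => Function.invFun_eq ⟨y, rfl⟩
  have hgen : ∀ {y : P}, y ≠ 0 → ∀ z : Q × P × ZMod 2, _ :=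
    fun {y} hy z => genericStarter_cases hσ' hQ hy z
  have haxis : ∀ z, _ := axisStarter_values (A := A) hQ hP' hc hω hcω hl he
  have hdis : ∀ y : P, y ≠ 0 → ∀ z z',
      genericStarter σ y z ≠ axisStarter c (Function.invFun c) ω A e z' := by
    intro y hy z z' h
    have h1 := hgen hy z
    have h2 := haxis z'
    rw [← h] at h2
    rcases h2 with h2 | h2
    · exact h2.2 (h1.2.2 h2.1)
    · have := h1.2.1 (h2.2.2 h1.1)
      rw [h2.1] at this
      exact zero_ne_one this
  let δ : Option {y : P // y ≠ 0} → Q × P × ZMod 2 → Q × P × ZMod 2 :=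
    fun i => i.elim (axisStarter c (Function.invFun c) ω A e) (fun y => genericStarter σ y.1)
  refine hasInvariantFactorization_of_starters δ ?_ _ ?_ ?_ ?_ ?_
  · rintro (_ | ⟨y, hy⟩)
    · exact isStarter_axisStarter hQ hl hc hω hcω hA hAω (hne e he)
    · exact isStarter_genericStarter hσ hσ' hQ (hne y hy)
  · rintro ⟨x, y, ε⟩ hz
    simpa using hz
  · rintro (_ | ⟨y, hy⟩) (_ | ⟨y', hy'⟩) z z' hz
    · rfl
    · exact absurd hz.symm (hdis y' hy' z' z)
    · exact absurd hz (hdis y hy z z')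
    · rcases eq_or_eq_neg_of_genericStarter_eq hσ' hz with rfl | rfl
      · rfl
      · exact range_genericStarter_neg y'
  · rintro (_ | ⟨y, hy⟩) z ⟨h3, h4⟩
    · rcases haxis z with h | h
      · exact h.2 h3
      · exact h.2.1 h3 h4
    · exact (hgen hy z).1 h4
  · rintro ⟨x, y, ε⟩ hz
    rcases h2 ε with rfl | rfl
    swap
    · exact Or.inr ⟨(AddMonoidHom.snd _ _).comp (AddMonoidHom.snd _ _), rfl⟩
    left
    obtain ⟨t, ht⟩ := hQ' (-x)
    have ht' : -(t + t) = x := by rw [ht, neg_neg]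
    by_cases hx : x = 0
    · have hy : y ≠ 0 := fun hy => hz ⟨hx, hy⟩
      obtain ⟨w, rfl⟩ := hP' y
      have hw : w ≠ 0 := by rintro rfl; simp at hy
      have hcw : c w ≠ 0 := fun h => hw (hc (h.trans (map_zero c).symm))
      refine ⟨none, (c w, 0, 0), ?_⟩
      simp [δ, axisStarter, hcw, hx, Function.leftInverse_invFun hc w]
    · have ht0 : t ≠ 0 := by rintro rfl; exact hx (by rw [← ht']; simp)
      by_cases hy : y = 0
      · subst hy
        by_cases h : t ∈ Set.range c ∨ A t
        · refine ⟨none, (t, 0, 1), ?_⟩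
          have : ¬ (t = 0 ∨ (t ∉ Set.range c ∧ ¬ A t)) := by tauto
          simp only [δ, Option.elim, axisStarter, map_zero, sub_zero, one_ne_zero, if_false, this,
            ht']
        · rw [not_or] at h
          refine ⟨none, (t, 0, 0), ?_⟩
          simp only [δ, Option.elim, axisStarter, map_zero, sub_zero, if_true, if_false, ht0, h.1,
            h.2, and_false, or_false, ht']
      · have hσy : σ t • y ≠ 0 := by rcases hσ' t with h | h <;> simpa [h] using hy
        refine ⟨some ⟨σ t • y, hσy⟩, (t, 0, 0), ?_⟩
        rcases hσ' t with h | h <;> simp [δ, genericStarter, ht0, h, ← ht']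

end

/-- If `b² ≡ -1` modulo `p`, raising to the power `p^k` lifts the congruence to modulus `p^(k+1)`,
and `(-1)^(p^k) = -1`; so `ω = b^(p^k)`. -/
theorem exists_mul_self_eq_neg_one_zmod_prime_pow {p : ℕ} [Fact p.Prime] (hp : p % 4 = 1)
    (k : ℕ) : ∃ ω : ZMod (p ^ (k + 1)), ω * ω = -1 := by
  obtain ⟨a, ha⟩ := (ZMod.exists_sq_eq_neg_one_iff (p := p)).2 (by omega)
  obtain ⟨b, rfl⟩ := ZMod.intCast_surjective a
  have h1 : ((p : ℕ) : ℤ) ∣ b ^ 2 - (-1) := by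
    rw [← ZMod.intCast_zmod_eq_zero_iff_dvd]
    push_cast
    rw [sq, ← ha]; ring
  have h2 := dvd_sub_pow_of_dvd_sub h1 k
  have hodd : Odd (p ^ k) := Odd.pow (Nat.odd_iff.2 (by omega))
  rw [hodd.neg_one_pow] at h2
  refine ⟨((b ^ p ^ k : ℤ) : ZMod (p ^ (k + 1))), ?_⟩
  have h3 := (ZMod.intCast_zmod_eq_zero_iff_dvd ((b ^ 2) ^ p ^ k - -1) (p ^ (k + 1))).2
    (by exact_mod_cast h2)
  push_cast at h3 ⊢
  linear_combination h3

/-- Multiplication by `p ^ k` embeds `ZMod p` into `ZMod (p ^ (k + 1))` as an ideal. -/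
theorem exists_injective_zmod_prime_pow (p : ℕ) [Fact p.Prime] (k : ℕ) :
    ∃ c : ZMod p →+ ZMod (p ^ (k + 1)), Function.Injective c ∧
      ∀ r y, r * c y ∈ Set.range c := by
  let f : ℤ →+ ZMod (p ^ (k + 1)) :=
    (AddMonoidHom.mulLeft ((p ^ k : ℕ) : ZMod (p ^ (k + 1)))).comp (Int.castAddHom _)
  have hf : f p = 0 := by
    simp only [f, AddMonoidHom.comp_apply, AddMonoidHom.coe_mulLeft, Int.coe_castAddHom,
      Int.cast_natCast]
    rw [← Nat.cast_mul, ← pow_succ, ZMod.natCast_self]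
  let c := ZMod.lift p ⟨f, hf⟩
  have hc : ∀ a : ℤ, c (a : ZMod p) = ((p ^ k : ℕ) : ZMod (p ^ (k + 1))) * (a : ZMod _) := by
    intro a
    simp [c, ZMod.lift_coe, f]
  refine ⟨c, ?_, ?_⟩
  · rw [injective_iff_map_eq_zero]
    intro y hy
    obtain ⟨a, rfl⟩ := ZMod.intCast_surjective y
    rw [hc] at hy
    have h1 : (((p ^ k : ℕ) * a : ℤ) : ZMod (p ^ (k + 1))) = 0 := by push_cast at hy ⊢; exact hy
    rw [ZMod.intCast_zmod_eq_zero_iff_dvd, pow_succ] at h1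
    push_cast at h1
    rw [ZMod.intCast_zmod_eq_zero_iff_dvd]
    refine Int.dvd_of_mul_dvd_mul_left (pow_ne_zero k ?_) h1
    exact_mod_cast (Fact.out : p.Prime).ne_zero
  · intro r y
    obtain ⟨a, rfl⟩ := ZMod.intCast_surjective y
    obtain ⟨b, rfl⟩ := ZMod.intCast_surjective r
    exact ⟨((b * a : ℤ) : ZMod p), by rw [hc, hc]; push_cast; ring⟩

theorem exists_abelianOneFactorization_of_prime_pow (p v : ℕ) (hp : p.Prime) (hp4 : p % 4 = 1)
    (hv : 2 ≤ v) :
    ∃ (𝓕 : Set (SimpleGraph (Fin (p ^ v) × Fin 2)))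
      (A : Subgroup (Equiv.Perm (Fin (p ^ v) × Fin 2))),
      IsAbelianOneFactorization (SimpleGraph.completeEquipartiteGraph (p ^ v) 2) 𝓕 A ∧
      Nonempty (A ≃* Multiplicative (ZMod (p ^ (v - 1)) × ZMod p × ZMod 2)) := by
  have : Fact p.Prime := ⟨hp⟩
  obtain ⟨k, rfl⟩ := Nat.exists_eq_add_of_le' hv
  rw [show k + 2 - 1 = k + 1 from rfl]
  have hpodd : Odd p := Nat.odd_iff.2 (by omega)
  have hqodd : Odd (p ^ (k + 1)) := hpodd.pow
  have hq1 : 1 < p ^ (k + 1) := Nat.one_lt_pow (by omega) hp.one_lt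
  have : NeZero (p ^ (k + 1)) := ⟨by omega⟩
  have : Nontrivial (ZMod (p ^ (k + 1))) := ZMod.nontrivial_iff.2 (by omega)
  obtain ⟨ω, hω⟩ := exists_mul_self_eq_neg_one_zmod_prime_pow hp4 k
  obtain ⟨c, hc, hcr⟩ := exists_injective_zmod_prime_pow p k
  have hQ := ZMod.add_self_injective_of_odd hqodd
  have hQ0 : ∀ x : ZMod (p ^ (k + 1)), x + x = 0 → x = 0 := fun x hx =>
    hQ x 0 (by rw [hx, add_zero])
  -- With absolutely least residues, `σ` is the sign and `A x` says `|x| < |ω x|`. As `ω² x = -x`,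
  -- multiplication by `ω` reverses this inequality.
  have hF := hasInvariantFactorization_of_sq_eq_neg_one (ω := ω) (e := (1 : ZMod p))
    (σ := fun x => if 0 ≤ x.valMinAbs then 1 else -1)
    (A := fun x => x.valMinAbs.natAbs < (ω * x).valMinAbs.natAbs)
    hQ (ZMod.exists_add_self_of_odd hqodd)
    (ZMod.add_self_injective_of_odd hpodd) (ZMod.exists_add_self_of_odd hpodd) hc hω
    (by
      intro u
      constructor
      · rintro ⟨y, hy⟩
        have := hcr (-ω) y
        rw [hy] at this
        rwa [show -ω * (ω * u) = u by linear_combination -u * hω] at this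
      · rintro ⟨y, rfl⟩
        exact hcr ω y)
    (by
      intro x hx
      have h1 : x.valMinAbs ≠ 0 := by rwa [ne_eq, ZMod.valMinAbs_eq_zero]
      have h2 : (-x).valMinAbs = -x.valMinAbs := ZMod.valMinAbs_neg_of_ne_half (by
        obtain ⟨a, ha⟩ := hqodd; omega)
      rw [h2]
      split_ifs <;> omega)
    (by intro x; split_ifs <;> simp)
    (by intro u; simp [ZMod.natAbs_valMinAbs_neg])
    (by
      intro u hu
      rw [show ω * (ω * u) = -u by linear_combination u * hω, ZMod.natAbs_valMinAbs_neg]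
      -- Equality would mean `ω u = ± u`, whence `2u = 0`.
      have : u.valMinAbs.natAbs ≠ (ω * u).valMinAbs.natAbs := by
        rw [ne_eq, ZMod.natAbs_valMinAbs_eq_natAbs_valMinAbs]
        rintro (h | h)
        · exact hu (hQ0 u (by linear_combination (1 + ω) * h + u * hω))
        · exact hu (hQ0 u (by linear_combination (1 - ω) * h + u * hω))
      omega)
    one_ne_zero
  let H : AddSubgroup (ZMod (p ^ (k + 1)) × ZMod p × ZMod 2) :=
    (⊥ : AddSubgroup _).prod ((⊥ : AddSubgroup _).prod ⊤)
  have hcard : Nat.card H = 2 := by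
    rw [Nat.card_congr (AddSubgroup.prodEquiv _ _).toEquiv, Nat.card_prod,
      Nat.card_congr (AddSubgroup.prodEquiv _ _).toEquiv, Nat.card_prod]
    simp
  have hindex : H.index = p ^ (k + 2) := by
    have h := H.card_mul_index
    simp only [hcard, Nat.card_prod, Nat.card_zmod] at h
    apply Nat.eq_of_mul_eq_mul_left two_pos
    rw [h]; ring
  have hHF : HasInvariantFactorization {x | x ∉ H} := by
    convert hF using 1
    ext z
    simp only [Set.mem_ofPred_eq, H, AddSubgroup.mem_prod, AddSubgroup.mem_bot,
      AddSubgroup.mem_top, and_true]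
  exact hHF.exists_isAbelianOneFactorization hindex hcard (AddEquiv.refl _)

/-! ### Nonexistence: involutions and counting. -/

theorem even_card_of_involution {α : Type*} (s : Finset α) (g : α → α) (hg : ∀ a ∈ s, g a ∈ s)
    (hgg : ∀ a ∈ s, g (g a) = a) (hne : ∀ a ∈ s, g a ≠ a) : Even s.card := by
  have h := Finset.sum_involution (s := s) (f := fun _ => (1 : ZMod 2)) (fun a _ => g a)
    (fun _ _ => by decide) (fun a ha _ => hne a ha) hg hgg
  rw [Finset.sum_const, nsmul_one, ZMod.natCast_eq_zero_iff] at h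
  exact even_iff_two_dvd.2 h

theorem SimpleGraph.map_perm_mul {V : Type*} (F : SimpleGraph V) (σ τ : Equiv.Perm V) :
    F.map (σ * τ) = (F.map τ).map σ := by
  ext x y
  simp only [map_equiv_adj]
  rfl

theorem SimpleGraph.map_perm_one {V : Type*} (F : SimpleGraph V) :
    F.map (1 : Equiv.Perm V) = F := by
  ext x y
  rw [map_equiv_adj]
  rfl

theorem SimpleGraph.map_perm_pow {V : Type*} {F : SimpleGraph V} {σ : Equiv.Perm V}
    (h : F.map σ = F) (k : ℕ) : F.map (σ ^ k : Equiv.Perm V) = F := by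
  induction k with
  | zero => rw [pow_zero, map_perm_one]
  | succ k ih => rw [pow_succ, map_perm_mul, h, ih]

/-- A fixed-point-free involution of the vertices that preserves each part. -/
structure IsPartInvolution {m n : ℕ} (j : Equiv.Perm (Fin m × Fin n)) : Prop where
  apply_apply : ∀ x, j (j x) = x
  apply_ne : ∀ x, j x ≠ x
  fst_apply : ∀ x, (j x).1 = x.1

/-- A set of representatives for the orbits of a part-preserving involution. -/
def halfVertices {m n : ℕ} (j : Equiv.Perm (Fin m × Fin n)) : Finset (Fin m × Fin n) :=
  Finset.univ.filter fun x => x.2 < (j x).2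

section
variable {m n : ℕ} {j : Equiv.Perm (Fin m × Fin n)}

theorem IsPartInvolution.apply_mem_half (hj : IsPartInvolution j) (x : Fin m × Fin n) :
    j x ∈ halfVertices j ↔ x ∉ halfVertices j := by
  have h1 : (j x).2 ≠ x.2 := fun h => hj.apply_ne x (Prod.ext (hj.fst_apply x) h)
  simp only [halfVertices, Finset.mem_filter, Finset.mem_univ, true_and, hj.apply_apply, not_lt]
  exact ⟨le_of_lt, fun h => lt_of_le_of_ne h h1⟩

theorem IsPartInvolution.two_mul_card_filter_notMem (hj : IsPartInvolution j) (P : Fin m → Prop)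
    [DecidablePred P] :
    2 * (Finset.univ.filter fun x => x ∉ halfVertices j ∧ P x.1).card =
      (Finset.univ.filter fun x : Fin m × Fin n => P x.1).card := by
  have h1 : (Finset.univ.filter fun x => x ∈ halfVertices j ∧ P x.1).card =
      (Finset.univ.filter fun x => x ∉ halfVertices j ∧ P x.1).card := by
    refine Finset.card_bij' (fun x _ => j x) (fun x _ => j x) ?_ ?_ ?_ ?_
    · intro x hx
      simp only [Finset.mem_filter, Finset.mem_univ, true_and, hj.apply_mem_half,
        hj.fst_apply, not_not] at hx ⊢
      exact hx
    · intro x hx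
      simp only [Finset.mem_filter, Finset.mem_univ, true_and, hj.apply_mem_half,
        hj.fst_apply] at hx ⊢
      exact hx
    · exact fun x _ => hj.apply_apply x
    · exact fun x _ => hj.apply_apply x
  rw [two_mul]
  nth_rewrite 1 [← h1]
  rw [← Finset.card_union_of_disjoint]
  · congr 1
    ext x
    simp only [Finset.mem_union, Finset.mem_filter, Finset.mem_univ, true_and]
    tauto
  · rw [Finset.disjoint_left]
    intro x hx hx'
    simp only [Finset.mem_filter, Finset.mem_univ, true_and] at hx hx'
    exact hx'.1 hx.1

theorem IsPartInvolution.two_mul_card_half (hj : IsPartInvolution j) :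
    2 * (halfVertices j).card = m * n := by
  have h1 := hj.two_mul_card_filter_notMem (fun _ => True)
  have h2 := Finset.card_filter_add_card_filter_not (s := Finset.univ) (· ∈ halfVertices j)
  simp only [and_true, Finset.filter_true, Finset.card_univ, Fintype.card_prod,
    Fintype.card_fin, Finset.filter_univ_mem] at h1 h2
  omega

/-- A factor fixed by `j` induces an involution on the `j`-orbits. It has no fixed orbit, since no
edge joins `x` to `j x`, which lie in one part. So the number of orbits would be even. -/
theorem IsPartInvolution.map_ne {F : SimpleGraph (Fin m × Fin n)} (hj : IsPartInvolution j)
    (hodd : Odd (halfVertices j).card)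
    (hF : IsOneFactor (SimpleGraph.completeEquipartiteGraph m n) F) : F.map j ≠ F := by
  intro h
  obtain ⟨hle, hF⟩ := hF
  choose f hf hfu using hF
  have hff : ∀ x, f (f x) = x := fun x => (hfu _ _ (hf x).symm).symm
  have hne : ∀ x, f x ≠ x := fun x h => (hf x).ne h.symm
  have hjf : ∀ x, f (j x) = j (f x) := by
    intro x
    refine (hfu _ _ ?_).symm
    change F.Adj (j x) (j (f x))
    rw [← h, map_equiv_adj]
    simpa using hf x
  have hjne : ∀ x, j (f x) ≠ x := by
    intro x hx
    have h1 := hle (hf x)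
    rw [SimpleGraph.completeEquipartiteGraph_adj, ← hj.fst_apply (f x), hx] at h1
    exact h1 rfl
  rw [← Nat.not_even_iff_odd] at hodd
  apply hodd
  -- The induced involution on orbits, read on their representatives.
  refine even_card_of_involution _ (fun x => if f x ∈ halfVertices j then f x else j (f x))
    ?_ ?_ ?_
  · intro x hx
    split_ifs with h1
    · exact h1
    · exact (hj.apply_mem_half _).2 h1
  · intro x hx
    by_cases h1 : f x ∈ halfVertices j
    · simp only [h1, if_true, hff, hx]
    · have : f (j (f x)) = j x := by rw [hjf, hff]
      simp only [h1, if_false, this, hj.apply_mem_half, hx, not_true, hj.apply_apply]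
  · intro x hx
    split_ifs
    · exact hne x
    · exact hjne x

open Classical in
theorem IsOneFactorization.card_toFinset {𝓕 : Set (SimpleGraph (Fin m × Fin n))}
    (h : IsOneFactorization (SimpleGraph.completeEquipartiteGraph m n) 𝓕) (x : Fin m × Fin n) :
    𝓕.toFinset.card = (Finset.univ.filter fun y : Fin m × Fin n => y.1 ≠ x.1).card := by
  obtain ⟨h1, h2⟩ := h
  choose f hf hfu using fun F (hF : F ∈ 𝓕) => (h1 F hF).2 x
  refine Finset.card_bij (fun F hF => f F (Set.mem_toFinset.1 hF)) ?_ ?_ ?_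
  · intro F hF
    rw [Finset.mem_filter]
    exact ⟨Finset.mem_univ _, Ne.symm ((h1 F (Set.mem_toFinset.1 hF)).1 (hf F (Set.mem_toFinset.1 hF)))⟩
  · intro F hF E hE hEF
    have hF' := Set.mem_toFinset.1 hF
    have hE' := Set.mem_toFinset.1 hE
    refine (h2 _ _ ((h1 F hF').1 (hf F hF'))).unique ⟨hF', hf F hF'⟩ ⟨hE', ?_⟩
    rw [hEF]; exact hf E hE'
  · intro y hy
    rw [Finset.mem_filter] at hy
    obtain ⟨F, ⟨hF, hxy⟩, -⟩ := h2 x y (Ne.symm hy.2)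
    exact ⟨F, Set.mem_toFinset.2 hF, (hfu F hF y hxy).symm⟩

theorem card_filter_fst_ne (x : Fin m × Fin n) :
    (Finset.univ.filter fun y : Fin m × Fin n => y.1 ≠ x.1).card = (m - 1) * n := by
  rw [show (Finset.univ.filter fun y : Fin m × Fin n => y.1 ≠ x.1) =
    (Finset.univ.erase x.1) ×ˢ Finset.univ by ext y; simp, Finset.card_product,
    Finset.card_erase_of_mem (Finset.mem_univ _)]
  simp

variable {𝓕 : Set (SimpleGraph (Fin m × Fin n))} {A : Subgroup (Equiv.Perm (Fin m × Fin n))}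

/-- Mapping factors to factors, `σ` maps edges to edges, and so does its inverse; lying in one part
means being non-adjacent. -/
theorem IsAbelianOneFactorization.fst_eq_iff
    (h : IsAbelianOneFactorization (SimpleGraph.completeEquipartiteGraph m n) 𝓕 A)
    {σ : Equiv.Perm (Fin m × Fin n)} (hσ : σ ∈ A) (x y : Fin m × Fin n) :
    (σ x).1 = (σ y).1 ↔ x.1 = y.1 := by
  have key : ∀ σ ∈ A, ∀ x y, (σ x).1 = (σ y).1 → x.1 = y.1 := by
    intro σ hσ x y hxy
    by_contra hne
    obtain ⟨F, ⟨hF, hF'⟩, -⟩ := h.factorization.2 x y hne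
    have h1 := h.autGroup σ hσ F hF
    exact (h.factorization.1 _ h1).1
      (show (F.map σ).Adj (σ x) (σ y) by rw [map_equiv_adj]; simpa using hF') hxy
  refine ⟨key σ hσ x y, fun hxy => key σ⁻¹ (A.inv_mem hσ) _ _ ?_⟩
  simpa using hxy

theorem IsSharplyTransitive.eq_of_apply_eq {V : Type*} {A : Subgroup (Equiv.Perm V)}
    (h : IsSharplyTransitive A) {σ τ : Equiv.Perm V} (hσ : σ ∈ A) (hτ : τ ∈ A) {x : V}
    (hx : σ x = τ x) : σ = τ :=
  (h x (τ x)).unique ⟨hσ, hx⟩ ⟨hτ, rfl⟩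

/-- The elements of `A` preserving every part form a subgroup of order `n`, to which Cauchy's
theorem applies. -/
theorem IsAbelianOneFactorization.exists_isPartInvolution
    (h : IsAbelianOneFactorization (SimpleGraph.completeEquipartiteGraph m n) 𝓕 A)
    (hn : 2 ∣ n) (x₀ : Fin m × Fin n) : ∃ j ∈ A, IsPartInvolution j := by
  let H : Subgroup (Equiv.Perm (Fin m × Fin n)) :=
    { carrier := {σ | σ ∈ A ∧ ∀ x, (σ x).1 = x.1}
      one_mem' := ⟨A.one_mem, fun x => rfl⟩
      mul_mem' := fun {σ τ} hσ hτ => ⟨A.mul_mem hσ.1 hτ.1, fun x => by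
        rw [Equiv.Perm.mul_apply, hσ.2, hτ.2]⟩
      inv_mem' := fun {σ} hσ => ⟨A.inv_mem hσ.1, fun x => by
        rw [← hσ.2 (σ⁻¹ x)]; simp⟩ }
  have hcard : Nat.card H = n := by
    refine (Nat.card_eq_of_bijective (fun σ : H => (σ.1 x₀).2) ⟨?_, ?_⟩).trans (Nat.card_fin n)
    · intro σ τ hστ
      refine Subtype.ext (h.sharplyTransitive.eq_of_apply_eq (x := x₀) σ.2.1 τ.2.1 ?_)
      exact Prod.ext ((σ.2.2 x₀).trans (τ.2.2 x₀).symm) hστ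
    · intro i
      obtain ⟨σ, ⟨hσ, hσx⟩, -⟩ := h.sharplyTransitive x₀ (x₀.1, i)
      refine ⟨⟨σ, hσ, fun x => ?_⟩, by simp [hσx]⟩
      obtain ⟨τ, ⟨hτ, rfl⟩, -⟩ := h.sharplyTransitive x₀ x
      -- Commutativity carries the preservation of the part of `x₀` over to every other part.
      rw [← Equiv.Perm.mul_apply, h.abelian σ hσ τ hτ, Equiv.Perm.mul_apply,
        h.fst_eq_iff hτ, hσx]
  have : Fact (Nat.Prime 2) := ⟨Nat.prime_two⟩
  obtain ⟨j, hj⟩ := exists_prime_orderOf_dvd_card' (G := H) 2 (by rw [hcard]; exact hn)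
  have hj1 : j.1 ≠ 1 := by
    intro h1
    have : j = 1 := Subtype.ext h1
    rw [this, orderOf_one] at hj
    omega
  refine ⟨j, j.2.1, ⟨fun x => ?_, fun x hx => hj1 ?_, j.2.2⟩⟩
  · have h1 : j ^ 2 = 1 := by rw [← hj, pow_orderOf_eq_one]
    have h2 : j.1 ^ 2 = 1 := congrArg Subtype.val h1
    rw [← Equiv.Perm.mul_apply, ← sq, h2, Equiv.Perm.one_apply]
  · exact h.sharplyTransitive.eq_of_apply_eq j.2.1 A.one_mem (x := x) hx

end

open Classical in
theorem not_exists_abelianOneFactorization_of_mod_four (m d : ℕ) (hm : m % 4 = 3) (hd : Odd d) :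
    ¬ ∃ (𝓕 : Set (SimpleGraph (Fin m × Fin (2 * d))))
        (A : Subgroup (Equiv.Perm (Fin m × Fin (2 * d)))),
        IsAbelianOneFactorization (SimpleGraph.completeEquipartiteGraph m (2 * d)) 𝓕 A := by
  rintro ⟨𝓕, A, h⟩
  have hd0 : 0 < d := hd.pos
  let x₀ : Fin m × Fin (2 * d) := (⟨0, by omega⟩, ⟨0, by omega⟩)
  obtain ⟨j, hjA, hj⟩ := h.exists_isPartInvolution ⟨d, rfl⟩ x₀
  set E := halfVertices j with hE
  have hEcard : E.card = m * d := by
    have := hj.two_mul_card_half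
    apply Nat.eq_of_mul_eq_mul_left two_pos
    rw [← hE] at this
    rw [this]; ring
  have hmodd : Odd m := Nat.odd_iff.2 (by omega)
  have hEodd : Odd E.card := by rw [hEcard]; exact hmodd.mul hd
  have hsymm : ∀ x, j.symm x = j x := fun x => by rw [Equiv.symm_apply_eq, hj.apply_apply]
  have hjm : ∀ F ∈ 𝓕, F.map j ∈ 𝓕 := fun F hF => h.autGroup j hjA F hF
  have hpart : ∀ F : SimpleGraph (Fin m × Fin (2 * d)), ∃ f : Fin m × Fin (2 * d) → _,
      F ∈ 𝓕 → ∀ x y, F.Adj x y ↔ f x = y := by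
    intro F
    by_cases hF : F ∈ 𝓕
    · choose f hf hfu using (h.factorization.1 F hF).2
      exact ⟨f, fun _ x y => ⟨fun hxy => (hfu x y hxy).symm, fun hxy => hxy ▸ hf x⟩⟩
    · exact ⟨id, fun hF' => absurd hF' hF⟩
  choose f hf using hpart
  have hff : ∀ F ∈ 𝓕, ∀ x, f F (f F x) = x := fun F hF x =>
    (hf F hF _ _).1 ((hf F hF _ _).2 rfl).symm
  have hfj : ∀ F ∈ 𝓕, ∀ x, f (F.map j) x = j (f F (j x)) := by
    intro F hF x
    rw [← hf _ (hjm F hF), map_equiv_adj, hsymm, hsymm, hj.apply_apply, hf F hF]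
  -- The number of edges of `F` between `E` and its complement. It is odd, because `E` is odd and
  -- the other vertices of `E` are matched within `E`.
  let c : SimpleGraph (Fin m × Fin (2 * d)) → ℕ := fun F => (E.filter fun x => f F x ∉ E).card
  have hcodd : ∀ F ∈ 𝓕, Odd (c F) := by
    intro F hF
    have h1 := Finset.card_filter_add_card_filter_not (s := E) (fun x => f F x ∈ E)
    have h2 : Even (E.filter fun x => f F x ∈ E).card := by
      refine even_card_of_involution _ (f F) ?_ (fun x _ => hff F hF x) ?_
      · intro x hx
        rw [Finset.mem_filter] at hx ⊢
        exact ⟨hx.2, by rw [hff F hF]; exact hx.1⟩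
      · exact fun x _ hx => ((hf F hF x x).2 hx).ne rfl
    rw [← h1, Nat.odd_add'] at hEodd
    exact hEodd.2 h2
  have hcj : ∀ F ∈ 𝓕, c (F.map j) = c F := by
    intro F hF
    refine Finset.card_bij' (fun x _ => f F (j x)) (fun x _ => j (f F x)) ?_ ?_ ?_ ?_
    · intro x hx
      rw [Finset.mem_filter, hfj F hF, hj.apply_mem_half, not_not] at hx
      rw [Finset.mem_filter, hff F hF, hj.apply_mem_half, not_not]
      exact hx.symm
    · intro x hx
      rw [Finset.mem_filter] at hx
      rw [Finset.mem_filter, hfj F hF, hj.apply_apply, hff F hF, hj.apply_mem_half,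
        hj.apply_mem_half, not_not]
      exact hx.symm
    · intro x hx; rw [hff F hF, hj.apply_apply]
    · intro x hx; rw [hj.apply_apply, hff F hF]
  have hcardF : 𝓕.toFinset.card = (m - 1) * (2 * d) := by
    rw [h.factorization.card_toFinset x₀, card_filter_fst_ne]
  -- The complement of `E` contains half of each part, so each vertex of `E` has `(m - 1) * d`
  -- neighbours there.
  have hsum : ∑ F ∈ 𝓕.toFinset, c F = m * d * ((m - 1) * d) := by
    have h1 : ∀ F ∈ 𝓕.toFinset, c F =
        ∑ x ∈ E, ∑ y ∈ Finset.univ.filter (· ∉ E), if F.Adj x y then 1 else 0 := by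
      intro F hF
      rw [Set.mem_toFinset] at hF
      simp only [c, Finset.card_filter]
      refine Finset.sum_congr rfl fun x _ => ?_
      simp only [hf F hF, Finset.sum_ite_eq, Finset.mem_filter, Finset.mem_univ, true_and]
    rw [Finset.sum_congr rfl h1, Finset.sum_comm]
    have h2 : ∀ x ∈ E, ∑ F ∈ 𝓕.toFinset, ∑ y ∈ Finset.univ.filter (· ∉ E),
        (if F.Adj x y then 1 else 0) = (m - 1) * d := by
      intro x _
      rw [Finset.sum_comm]
      have h3 : ∀ y, ∑ F ∈ 𝓕.toFinset, (if F.Adj x y then 1 else 0) =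
          if y.1 ≠ x.1 then 1 else 0 := by
        intro y
        rw [← Finset.card_filter]
        split_ifs with hxy
        · obtain ⟨F, hF, hu⟩ := h.factorization.2 x y (Ne.symm hxy)
          rw [Finset.card_eq_one]
          refine ⟨F, ?_⟩
          ext F'
          rw [Finset.mem_filter, Set.mem_toFinset, Finset.mem_singleton]
          exact ⟨fun h' => hu F' h', fun h' => h' ▸ hF⟩
        · rw [Finset.card_eq_zero, Finset.filter_eq_empty_iff]
          intro F hF hadj
          exact hxy (Ne.symm ((h.factorization.1 F (Set.mem_toFinset.1 hF)).1 hadj))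
      rw [Finset.sum_congr rfl (fun y _ => h3 y), ← Finset.card_filter, Finset.filter_filter]
      have h4 := hj.two_mul_card_filter_notMem (fun a => a ≠ x.1)
      rw [card_filter_fst_ne] at h4
      apply Nat.eq_of_mul_eq_mul_left two_pos
      rw [h4]; ring
    rw [Finset.sum_congr rfl h2, Finset.sum_const, hEcard, smul_eq_mul]
  -- `F` and `jF` are distinct and have the same `c`, so their contributions cancel modulo 2.
  have hb : Even (∑ F ∈ 𝓕.toFinset, c F / 2) := by
    rw [even_iff_two_dvd, ← ZMod.natCast_eq_zero_iff, Nat.cast_sum]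
    refine Finset.sum_involution (fun F _ => F.map j) ?_ ?_ ?_ ?_
    · intro F hF
      rw [hcj F (Set.mem_toFinset.1 hF)]
      generalize ((c F / 2 : ℕ) : ZMod 2) = a
      revert a; decide
    · intro F hF _
      exact hj.map_ne hEodd (h.factorization.1 F (Set.mem_toFinset.1 hF))
    · intro F hF
      exact Set.mem_toFinset.2 (hjm F (Set.mem_toFinset.1 hF))
    · intro F hF
      rw [← SimpleGraph.map_perm_mul, show j * j = 1 from Equiv.ext hj.apply_apply,
        SimpleGraph.map_perm_one]
  have hsum' : ∑ F ∈ 𝓕.toFinset, c F = 2 * ∑ F ∈ 𝓕.toFinset, c F / 2 + 𝓕.toFinset.card := by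
    rw [Finset.mul_sum, Finset.card_eq_sum_ones, ← Finset.sum_add_distrib]
    refine Finset.sum_congr rfl fun F hF => ?_
    obtain ⟨k, hk⟩ := hcodd F (Set.mem_toFinset.1 hF)
    omega
  obtain ⟨b, hb⟩ := hb
  rw [hsum, hb, hcardF] at hsum'
  obtain ⟨t, rfl⟩ : ∃ t, m = 4 * t + 3 := ⟨m / 4, by omega⟩
  rw [show 4 * t + 3 - 1 = 2 * (2 * t + 1) by omega] at hsum'
  -- After division by 2 the left side is odd, because both `m` and `(m - 1) / 2` are.
  have h5 : (4 * t + 3) * d * ((2 * t + 1) * d) = 2 * (b + (2 * t + 1) * d) := by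
    apply Nat.eq_of_mul_eq_mul_left two_pos
    linarith
  have h6 : Odd ((4 * t + 3) * d * ((2 * t + 1) * d)) :=
    (hmodd.mul hd).mul (Odd.mul ⟨t, rfl⟩ hd)
  rw [h5] at h6
  exact (Nat.not_even_iff_odd.2 h6) (even_two_mul _)

theorem not_exists_abelianOneFactorization_of_prime (p : ℕ) (hp : p.Prime) (hp4 : p % 4 = 1) :
    ¬ ∃ (𝓕 : Set (SimpleGraph (Fin p × Fin 2))) (A : Subgroup (Equiv.Perm (Fin p × Fin 2))),
        IsAbelianOneFactorization (SimpleGraph.completeEquipartiteGraph p 2) 𝓕 A := by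
  classical
  rintro ⟨𝓕, A, h⟩
  have : Fact p.Prime := ⟨hp⟩
  have hp2 := hp.two_le
  let x₀ : Fin p × Fin 2 := (⟨0, by omega⟩, 0)
  obtain ⟨j, hjA, hj⟩ := h.exists_isPartInvolution ⟨1, rfl⟩ x₀
  have hEodd : Odd (halfVertices j).card := by
    have := hj.two_mul_card_half
    rw [Nat.odd_iff]; omega
  have hjne : ∀ F ∈ 𝓕, F.map j ≠ F := fun F hF => hj.map_ne hEodd (h.factorization.1 F hF)
  let _ : CommGroup A := { (inferInstance : Group A) with
    mul_comm := fun σ τ => Subtype.ext (h.abelian σ σ.2 τ τ.2) }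
  have hcard : Nat.card A = 2 * p := by
    rw [Nat.card_eq_of_bijective (fun σ : A => σ.1 x₀) ⟨?_, ?_⟩]
    · simp [mul_comm]
    · exact fun σ τ hστ => Subtype.ext (h.sharplyTransitive.eq_of_apply_eq σ.2 τ.2 hστ)
    · intro y
      obtain ⟨σ, ⟨hσ, hσx⟩, -⟩ := h.sharplyTransitive x₀ y
      exact ⟨⟨σ, hσ⟩, hσx⟩
  have hcardF : 𝓕.toFinset.card = (p - 1) * 2 := by
    rw [h.factorization.card_toFinset x₀, card_filter_fst_ne]
  obtain ⟨g, hg⟩ := exists_prime_orderOf_dvd_card' (G := A) p (by rw [hcard]; exact ⟨2, by ring⟩)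
  let j' : A := ⟨j, hjA⟩
  have hj1 : j' ≠ 1 := fun h1 => hj.apply_ne x₀ (by
    have : j = 1 := congrArg Subtype.val h1
    rw [this, Equiv.Perm.one_apply])
  have hj' : orderOf j' = 2 := orderOf_eq_prime
    (Subtype.ext (by rw [sq]; exact Equiv.ext hj.apply_apply)) hj1
  have hgg : g * g ≠ 1 := by
    intro h1
    have := orderOf_dvd_of_pow_eq_one (x := g) (n := 2) (by rw [sq, h1])
    rw [hg] at this
    have := Nat.le_of_dvd two_pos this
    omega
  -- With parts of size 2, an element of `A` sending `x₀` into its own part is `1` or `j`.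
  have hadj : (SimpleGraph.completeEquipartiteGraph p 2).Adj x₀ (g.1 x₀) := by
    rw [SimpleGraph.completeEquipartiteGraph_adj]
    intro hfst
    have h1 : (g.1 x₀).2 = x₀.2 ∨ (g.1 x₀).2 = (j x₀).2 := by
      have h2 : (j x₀).2 ≠ x₀.2 := fun h => hj.apply_ne x₀ (Prod.ext (hj.fst_apply x₀) h)
      generalize (g.1 x₀).2 = a at *
      generalize (j x₀).2 = b at *
      generalize x₀.2 = c at *
      revert a b c; decide
    rcases h1 with h1 | h1
    · have : g.1 = 1 := h.sharplyTransitive.eq_of_apply_eq g.2 A.one_mem (x := x₀)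
        (Prod.ext hfst.symm h1)
      exact hgg (by rw [show g = 1 from Subtype.ext this, one_mul])
    · have : g = j' := Subtype.ext (h.sharplyTransitive.eq_of_apply_eq g.2 hjA (x := x₀)
        (Prod.ext (hfst.symm.trans (hj.fst_apply x₀).symm) h1))
      rw [this, hj'] at hg
      omega
  obtain ⟨F, ⟨hF, hFadj⟩, -⟩ := h.factorization.2 _ _ hadj
  have hgF : F.map g.1 ≠ F := by
    intro h1
    have h2 : F.Adj (g.1 x₀) (g.1 (g.1 x₀)) := by
      rw [← h1, map_equiv_adj]; simpa using hFadj
    have h3 := ((h.factorization.1 F hF).2 (g.1 x₀)).unique h2 hFadj.symm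
    exact hgg (Subtype.ext (h.sharplyTransitive.eq_of_apply_eq (g * g).2 A.one_mem (x := x₀) h3))
  -- In a group of order `2p`, a stabilizer containing neither `j` nor `g` is trivial: `ρ^p` is `1`
  -- or `j`, and if `ρ` had order `p`, then `g` would be a power of `ρ²`.
  have hstab : ∀ ρ : A, F.map ρ.1 = F → ρ = 1 := by
    intro ρ hρ
    have hpow : ∀ k : ℕ, F.map (ρ ^ k : A).1 = F := fun k => SimpleGraph.map_perm_pow hρ k
    have hi1 : (Subgroup.zpowers g).index = 2 := by
      have := (Subgroup.zpowers g).card_mul_index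
      rw [Nat.card_zpowers, hg, hcard, mul_comm 2 p] at this
      exact Nat.eq_of_mul_eq_mul_left hp.pos this
    have hi2 : (Subgroup.zpowers j').index = p := by
      have := (Subgroup.zpowers j').card_mul_index
      rw [Nat.card_zpowers, hj', hcard] at this
      exact Nat.eq_of_mul_eq_mul_left two_pos this
    have h1 := (Subgroup.zpowers g).pow_index_mem ρ
    have h2 := (Subgroup.zpowers j').pow_index_mem ρ
    rw [hi1] at h1
    rw [hi2] at h2
    have h3 : ρ ^ p = 1 := by
      obtain ⟨i, hi, hi'⟩ := Finset.mem_image.1 (mem_zpowers_iff_mem_range_orderOf.1 h2)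
      rw [hj', Finset.mem_range] at hi
      interval_cases i
      · simpa using hi'.symm
      · refine absurd (hpow p) ?_
        rw [← hi', pow_one]
        exact hjne F hF
    by_contra hne
    have h4 : orderOf ρ = p := orderOf_eq_prime h3 hne
    have h5 : orderOf (ρ ^ 2) = p := by
      rw [orderOf_pow, h4, Nat.Coprime.gcd_eq_one, Nat.div_one]
      exact Nat.Coprime.symm (Nat.coprime_two_left.2 (Nat.odd_iff.2 (by omega)))
    have h6 : Subgroup.zpowers (ρ ^ 2) = Subgroup.zpowers g := by
      refine Subgroup.eq_of_le_of_card_ge (by rwa [Subgroup.zpowers_le]) ?_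
      rw [Nat.card_zpowers, Nat.card_zpowers, h5, hg]
    have h7 : g ∈ Subgroup.zpowers (ρ ^ 2) := by rw [h6]; exact Subgroup.mem_zpowers g
    obtain ⟨i, -, hi⟩ := Finset.mem_image.1 (mem_zpowers_iff_mem_range_orderOf.1 h7)
    apply hgF
    rw [← hi, ← pow_mul]
    exact hpow _
  have hle : Nat.card A ≤ 𝓕.toFinset.card := by
    rw [← Set.ncard_eq_toFinset_card', ← Nat.card_coe_set_eq]
    refine Nat.card_le_card_of_injective
      (fun σ : A => (⟨F.map σ.1, h.autGroup σ.1 σ.2 F hF⟩ : 𝓕)) ?_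
    intro σ τ hστ
    have h1 : F.map σ.1 = F.map τ.1 := congrArg Subtype.val hστ
    have h2 := hstab (τ⁻¹ * σ) (by
      change F.map (τ.1⁻¹ * σ.1 : Equiv.Perm _) = F
      rw [SimpleGraph.map_perm_mul, h1, ← SimpleGraph.map_perm_mul, inv_mul_cancel,
        SimpleGraph.map_perm_one])
    exact (inv_mul_eq_one.1 h2).symm
  omega

theorem mainTheorem1 :
    (∀ v d d' : ℕ, 2 ≤ v → Odd d → Odd d' →
      ∃ (𝓕 : Set (SimpleGraph (Fin (2 ^ v * d) × Fin (2 * d'))))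
        (A : Subgroup (Equiv.Perm (Fin (2 ^ v * d) × Fin (2 * d')))),
        IsAbelianOneFactorization
          (SimpleGraph.completeEquipartiteGraph (2 ^ v * d) (2 * d')) 𝓕 A ∧
        Nonempty (A ≃* Multiplicative (ZMod d × ZMod (2 ^ v * d') × ZMod 2))) ∧
    (∀ p : ℕ, p.Prime → p % 4 = 1 →
      ¬ ∃ (𝓕 : Set (SimpleGraph (Fin p × Fin 2))) (A : Subgroup (Equiv.Perm (Fin p × Fin 2))),
        IsAbelianOneFactorization (SimpleGraph.completeEquipartiteGraph p 2) 𝓕 A) ∧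
    (∀ p v : ℕ, p.Prime → p % 4 = 1 → 2 ≤ v →
      ∃ (𝓕 : Set (SimpleGraph (Fin (p ^ v) × Fin 2)))
        (A : Subgroup (Equiv.Perm (Fin (p ^ v) × Fin 2))),
        IsAbelianOneFactorization (SimpleGraph.completeEquipartiteGraph (p ^ v) 2) 𝓕 A ∧
        Nonempty (A ≃* Multiplicative (ZMod (p ^ (v - 1)) × ZMod p × ZMod 2))) ∧
    (∀ m d : ℕ, m % 4 = 3 → Odd d →
      ¬ ∃ (𝓕 : Set (SimpleGraph (Fin m × Fin (2 * d))))
        (A : Subgroup (Equiv.Perm (Fin m × Fin (2 * d)))),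
        IsAbelianOneFactorization (SimpleGraph.completeEquipartiteGraph m (2 * d)) 𝓕 A) :=
  ⟨exists_abelianOneFactorization_of_two_pow, not_exists_abelianOneFactorization_of_prime,
    exists_abelianOneFactorization_of_prime_pow,
    not_exists_abelianOneFactorization_of_mod_four⟩
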